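/- Write $\mathbb D=\{|z|<1\}$, $\mathbb T=\{|z|=1\}$, $\mathbb E=\{|z|>1\}$ in $\mathbb C$. Let $p\in\mathbb C[z,w]$ have degree $(n,m)$, that is, degree $n$ in $z$ and degree $m$ in $w$. Suppose that $p$ has no non-constant factor involving $z$ alone, and that its zero set $Z_p=\{(z,w)\in\mathbb C^2: p(z,w)=0\}$ is a generalized distinguished variety in the sense that $$Z_p\subset(\mathbb D\times\mathbb C)\cup\mathbb T^2\cup(\mathbb E\times\mathbb C),$$ i.e. $Z_p$ does not meet $(\mathbb T\times\mathbb D)\cup(\mathbb T\times\mathbb E)$. Let $n_2$ be the number of zeros of the polynomial $p(z,0)$ in $\mathbb D$, counted with multiplicity. Then $n_2\le n$ and, with $n_1=n-n_2$, there exist an $(m+n)\times(m+n)$ unitary matrix $U$ and a nonzero constant $c\in\mathbb C$ such that, identically in $(z,w)$, $$p(z,w)=c\,\det\bigl(U\Delta(z,w)-\Gamma(z,w)\bigr),$$ where $$\Delta(z,w)=\begin{pmatrix} wI_m&0&0\\0&zI_{n_1}&0\\0&0&I_{n_2}\end{pmatrix},\qquad \Gamma(z,w)=\begin{pmatrix}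 I_m&0&0\\0&I_{n_1}&0\\0&0&zI_{n_2}\end{pmatrix}.$$ -/

import Mathlib

/-- Polynomials in `ℂ[z,w]`; the variable `z` has index `0` and `w` has index `1`. -/
abbrev Poly2 : Type := MvPolynomial (Fin 2) ℂ

namespace Poly2

/-- The coordinate polynomial `z`. -/
noncomputable def z : Poly2 := MvPolynomial.X 0

/-- The coordinate polynomial `w`. -/
noncomputable def w : Poly2 := MvPolynomial.X 1

/-- `p` has degree `(n, m)`: degree `n` in `z` and degree `m` in `w`. -/
def HasBidegree (p : Poly2) (n m : ℕ) : Prop :=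
  MvPolynomial.degreeOf 0 p = n ∧ MvPolynomial.degreeOf 1 p = m

/-- `p` has no factor involving `z` alone: a factor of `p` that does not involve `w`
does not involve `z` either. -/
def NoFactorInZAlone (p : Poly2) : Prop :=
  ∀ q : Poly2, q ∣ p → MvPolynomial.degreeOf 1 q = 0 → MvPolynomial.degreeOf 0 q = 0

/-- The zero set of `p` in `ℂ²`. -/
def zeroSet (p : Poly2) : Set (ℂ × ℂ) :=
  {x | MvPolynomial.eval ![x.1, x.2] p = 0}

/-- The open unit disk. -/
def disk : Set ℂ := {x | ‖x‖ < 1}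

/-- The unit circle. -/
def circle : Set ℂ := {x | ‖x‖ = 1}

/-- The complement of the closed unit disk. -/
def exterior : Set ℂ := {x | 1 < ‖x‖}

/-- The zero set of `p` is a generalized distinguished variety (with respect to `z`):
it is contained in `(𝔻 × ℂ) ∪ 𝕋² ∪ (𝔼 × ℂ)`. -/
def IsGenDistinguished (p : Poly2) : Prop :=
  zeroSet p ⊆ (disk ×ˢ Set.univ) ∪ (circle ×ˢ circle) ∪ (exterior ×ˢ Set.univ)

/-- The one-variable polynomial `p(z, 0)`. -/
noncomputable def atWZero (p : Poly2) : Polynomial ℂ :=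
  MvPolynomial.aeval ![Polynomial.X, 0] p

open Classical in
/-- The number of zeros of `p(z, 0)` in the open unit disk, counted with multiplicity. -/
noncomputable def numZerosDisk (p : Poly2) : ℕ :=
  Multiset.card ((atWZero p).roots.filter (fun a => a ∈ disk))

/-- The block diagonal matrix `Δ(z,w) = diag(w I_m, z I_{n₁}, I_{n₂})`. -/
noncomputable def Delta (m n₁ n₂ : ℕ) :
    Matrix (Fin m ⊕ (Fin n₁ ⊕ Fin n₂)) (Fin m ⊕ (Fin n₁ ⊕ Fin n₂)) Poly2 :=
  Matrix.diagonal (Sum.elim (fun _ => w) (Sum.elim (fun _ => z) (fun _ => 1)))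

/-- The block diagonal matrix `Γ(z,w) = diag(I_m, I_{n₁}, z I_{n₂})`. -/
noncomputable def Gamma (m n₁ n₂ : ℕ) :
    Matrix (Fin m ⊕ (Fin n₁ ⊕ Fin n₂)) (Fin m ⊕ (Fin n₁ ⊕ Fin n₂)) Poly2 :=
  Matrix.diagonal (Sum.elim (fun _ => 1) (Sum.elim (fun _ => 1) (fun _ => z)))

end Poly2

/-! Both sides are multiplicative: a direct sum of unitaries multiplies determinants and adds block
sizes, and the count of zeros of p(z,0) in the disk is additive over factors. Constants have the
empty representation, so the content lies in an irreducible P of degree (n,m) with m > 0, viewed as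
a polynomial in w over ℂ[z].

Above |z| = 1 the curve P = 0 lies in 𝕋². Hence multiplication by z and by w are isometries Z, W for
the form averaging conj(f)·g over the points of the curve above the circle. In the resulting Hilbert
space let H ≤ H' be the closures of the polynomials of w-degree < m and ≤ m, and take orthonormal
bases ε of H ⊖ ZH, φ of H' ⊖ H and g of H' ⊖ WH. The families (Wε, Zφ, g) and (ε, φ, Zg) have the
same frame operator, so a unitary V carries one to the other (`IsometryModel.exists_unitary`).
Evaluation at a point of the curve with |z| < 1 is bounded on polynomials of w-degree ≤ m, for all
but finitely many z (`exists_norm_evalEval_le_norm`). Applied to the relation, it yields a kernel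
vector of VΔ − Γ at that point (`IsometryModel.det_pencil_eq_zero`), so P divides the determinant.

The determinant is not identically zero, since otherwise Z would have infinitely many eigenvalues on
a finite-dimensional space (`IsometryModel.exists_det_pencil_ne_zero`). Its degree is controlled by
the sizes of the three bases: at most m, n − n₂ and n₂. The last two bounds rest on the symmetry of
P under reflection in the torus (`exists_factorizations`). A nonzero multiple of P of degree at most
(n,m) is a constant multiple, and all the bounds become equalities. -/

open scoped InnerProductSpace

/-! ### Frame sums over orthogonal differences of subspaces. -/

section Hilbert

variable {K : Type*} [NormedAddCommGroup K] [InnerProductSpace ℂ K]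

/-- The family `ε` is an orthonormal basis of the orthogonal complement of `M` in `N`. -/
def IsOrthoDiffBasis {ι : Type*} (ε : ι → K) (M N : Submodule ℂ K) : Prop :=
  Orthonormal ℂ ε ∧ Submodule.span ℂ (Set.range ε) = Mᗮ ⊓ N

theorem Orthonormal.sum_norm_inner_sq_of_mem_span {ι : Type*} [Fintype ι] {ε : ι → K}
    (hε : Orthonormal ℂ ε) {y : K} (hy : y ∈ Submodule.span ℂ (Set.range ε)) :
    ∑ i, ‖⟪ε i, y⟫_ℂ‖ ^ 2 = ‖y‖ ^ 2 := by
  obtain ⟨c, rfl⟩ := (Submodule.mem_span_range_iff_exists_fun ℂ).1 hy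
  have h1 : ∀ i, ⟪ε i, ∑ j, c j • ε j⟫_ℂ = c i := fun i => hε.inner_right_fintype c i
  simp_rw [h1]
  have h2 : ((‖∑ j, c j • ε j‖ ^ 2 : ℝ) : ℂ) = ((∑ i, ‖c i‖ ^ 2 : ℝ) : ℂ) := by
    have := inner_self_eq_norm_sq_to_K (𝕜 := ℂ) (∑ j, c j • ε j)
    rw [hε.inner_sum] at this
    push_cast
    rw [← RCLike.ofReal_eq_complex_ofReal, ← this]
    refine Finset.sum_congr rfl fun i _ => ?_
    rw [mul_comm, Complex.mul_conj, Complex.normSq_eq_norm_sq]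
    norm_cast
  exact_mod_cast h2.symm

/-- Pythagoras for the projections of x onto M ≤ N. The basis disappears from the right side, so
frame sums over several differences can be compared by formal cancellation. -/
theorem IsOrthoDiffBasis.sum_norm_inner_sq {ι : Type*} [Fintype ι] {ε : ι → K}
    {M N : Submodule ℂ K} [M.HasOrthogonalProjection] [N.HasOrthogonalProjection]
    (h : IsOrthoDiffBasis ε M N) (hMN : M ≤ N) (x : K) :
    ∑ i, ‖⟪ε i, x⟫_ℂ‖ ^ 2 = ‖N.starProjection x‖ ^ 2 - ‖M.starProjection x‖ ^ 2 := by
  set y := N.starProjection x - M.starProjection x with hy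
  have hmem : ∀ i, ε i ∈ Mᗮ ⊓ N := fun i => h.2 ▸ Submodule.subset_span ⟨i, rfl⟩
  have hMx : M.starProjection x ∈ M := Submodule.starProjection_apply_mem M x
  have hNx : N.starProjection x ∈ N := Submodule.starProjection_apply_mem N x
  have hxN : x - N.starProjection x ∈ Nᗮ := Submodule.sub_starProjection_mem_orthogonal x
  have hxM : x - M.starProjection x ∈ Mᗮ := Submodule.sub_starProjection_mem_orthogonal x
  have hyM : y ∈ Mᗮ := by
    have : y = (x - M.starProjection x) - (x - N.starProjection x) := by rw [hy]; abel
    rw [this]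
    exact Submodule.sub_mem _ hxM (Submodule.orthogonal_le hMN hxN)
  have hyN : y ∈ N := Submodule.sub_mem _ hNx (hMN hMx)
  have hin : ∀ i, ⟪ε i, x⟫_ℂ = ⟪ε i, y⟫_ℂ := by
    intro i
    have h1 : ⟪ε i, x - N.starProjection x⟫_ℂ = 0 := hxN _ (hmem i).2
    have h2 : ⟪ε i, M.starProjection x⟫_ℂ = 0 := by
      rw [← inner_conj_symm, (hmem i).1 _ hMx, map_zero]
    rw [inner_sub_right, sub_eq_zero] at h1
    rw [hy, inner_sub_right, h2, h1, sub_zero]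
  simp_rw [hin]
  rw [h.1.sum_norm_inner_sq_of_mem_span (h.2 ▸ ⟨hyM, hyN⟩)]
  have h3 : N.starProjection x = M.starProjection x + y := by rw [hy]; abel
  rw [h3, sq, sq ‖M.starProjection x + y‖,
    norm_add_sq_eq_norm_sq_add_norm_sq_of_inner_eq_zero (𝕜 := ℂ) _ _ (hyM _ hMx)]
  ring

theorem IsOrthoDiffBasis.map {ι : Type*} {ε : ι → K} {M N : Submodule ℂ K}
    (h : IsOrthoDiffBasis ε M N) (T : K →ₗᵢ[ℂ] K) :
    IsOrthoDiffBasis (T ∘ ε) (M.map T.toLinearMap) (N.map T.toLinearMap) := by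
  refine ⟨h.1.comp_linearIsometry T, ?_⟩
  rw [Set.range_comp]
  have : (T : K → K) = T.toLinearMap := rfl
  rw [this, ← Submodule.map_span, h.2]
  ext y
  constructor
  · rintro ⟨x, hx, rfl⟩
    refine ⟨?_, x, hx.2, rfl⟩
    rintro _ ⟨v, hv, rfl⟩
    exact (T.inner_map_map v x).trans (hx.1 v hv)
  · rintro ⟨h1, x, hx, rfl⟩
    refine ⟨x, ⟨fun v hv => ?_, hx⟩, rfl⟩
    rw [← T.inner_map_map]
    exact h1 _ ⟨v, hv, rfl⟩

theorem exists_isOrthoDiffBasis (M N : Submodule ℂ K) [FiniteDimensional ℂ ↥(Mᗮ ⊓ N)] :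
    ∃ ε : Fin (Module.finrank ℂ ↥(Mᗮ ⊓ N)) → K, IsOrthoDiffBasis ε M N := by
  let b := stdOrthonormalBasis ℂ ↥(Mᗮ ⊓ N)
  refine ⟨fun i => (b i : K), b.orthonormal.comp_linearIsometry (Mᗮ ⊓ N).subtypeₗᵢ, ?_⟩
  have h1 : Set.range (fun i => (b i : K)) = (Mᗮ ⊓ N).subtype '' Set.range b := by
    rw [← Set.range_comp]; rfl
  rw [h1, ← Submodule.map_span, ← b.coe_toBasis, b.toBasis.span_eq, Submodule.map_top,
    Submodule.range_subtype]

/-- Two finite families with the same frame operator are related by a unitary matrix. -/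
theorem exists_unitary_of_sum_norm_inner_sq_eq {ι : Type*} [Fintype ι] [DecidableEq ι]
    (src tgt : ι → K)
    (h : ∀ x, ∑ i, ‖⟪src i, x⟫_ℂ‖ ^ 2 = ∑ i, ‖⟪tgt i, x⟫_ℂ‖ ^ 2) :
    ∃ V ∈ Matrix.unitaryGroup ι ℂ, ∀ i, tgt i = ∑ k, V i k • src k := by
  let S : K →ₗ[ℂ] EuclideanSpace ℂ ι :=
    { toFun := fun x => WithLp.toLp 2 fun i => ⟪src i, x⟫_ℂ
      map_add' := fun x y => by ext i; simp
      map_smul' := fun c x => by ext i; simp }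
  let T : K →ₗ[ℂ] EuclideanSpace ℂ ι :=
    { toFun := fun x => WithLp.toLp 2 fun i => ⟪tgt i, x⟫_ℂ
      map_add' := fun x y => by ext i; simp
      map_smul' := fun c x => by ext i; simp }
  have hST : ∀ x, ‖S x‖ = ‖T x‖ := fun x => by
    rw [EuclideanSpace.norm_eq, EuclideanSpace.norm_eq]
    exact congrArg _ (h x)
  have hker : S.ker ≤ T.ker := fun x hx => by
    rw [LinearMap.mem_ker] at hx ⊢
    rw [← norm_eq_zero, ← hST, hx, norm_zero]
  let L0 : S.range →ₗ[ℂ] EuclideanSpace ℂ ι :=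
    (S.ker.liftQ T hker).comp S.quotKerEquivRange.symm.toLinearMap
  have hL0 : ∀ x, L0 ⟨S x, x, rfl⟩ = T x := fun x => by
    have : S.quotKerEquivRange.symm ⟨S x, x, rfl⟩ = Submodule.Quotient.mk x := by
      rw [LinearEquiv.symm_apply_eq]; rfl
    simp [L0, this]
  let L1 : S.range →ₗᵢ[ℂ] EuclideanSpace ℂ ι :=
    ⟨L0, by rintro ⟨_, x, rfl⟩; rw [hL0, ← hST]; rfl⟩
  -- Equality of norms makes S x ↦ T x a well-defined isometry on the range of S; finite dimension
  -- of the target lets it extend to the whole space.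
  let L := L1.extend
  have hL : ∀ x, L (S x) = T x := fun x => by
    have := L1.extend_apply ⟨S x, x, rfl⟩
    exact this.trans (hL0 x)
  let A : Matrix ι ι ℂ := Matrix.of fun i k => L (EuclideanSpace.single k 1) i
  have hLA : ∀ v i, L v i = ∑ k, A i k * v k := fun v i => by
    have hv : v = ∑ k, v k • EuclideanSpace.single k (1 : ℂ) := by
      ext j; simp [Pi.single_apply]
    conv_lhs => rw [hv]
    simp [A, mul_comm]
  have hA : A ∈ Matrix.unitaryGroup ι ℂ := by
    rw [Matrix.mem_unitaryGroup_iff']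
    ext j k
    have h1 := L.inner_map_map (EuclideanSpace.single j 1) (EuclideanSpace.single k 1)
    rw [PiLp.inner_apply] at h1
    rw [Matrix.mul_apply]
    simp only [Matrix.star_apply, A, Matrix.of_apply]
    refine (Finset.sum_congr rfl fun i _ => ?_).trans (h1.trans ?_)
    · simp [mul_comm]
    · rw [EuclideanSpace.inner_single_left]
      simp [Matrix.one_apply]
  -- The matrix A relates the coefficients ⟪tgt i, x⟫ and ⟪src k, x⟫; conjugate linearity in the
  -- first slot forces the entrywise conjugate for the vectors themselves.
  refine ⟨A.map star, ?_, fun i => ?_⟩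
  · rw [Matrix.mem_unitaryGroup_iff] at hA ⊢
    have := congrArg (fun M : Matrix ι ι ℂ => M.map (starRingEnd ℂ)) hA
    simp only [Matrix.map_mul] at this
    rw [Matrix.map_one _ (map_zero _) (map_one _)] at this
    rw [← this]
    rfl
  · refine ext_inner_right ℂ fun x => ?_
    have h1 := hLA (S x) i
    rw [hL] at h1
    rw [sum_inner]
    refine h1.trans (Finset.sum_congr rfl fun k _ => ?_)
    rw [inner_smul_left]
    simp [S]

end Hilbert

theorem Complex.infinite_sphere : {z : ℂ | ‖z‖ = 1}.Infinite := by
  refine Set.infinite_of_injective_forall_mem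
    (f := fun k : ℕ => Complex.exp ((1 / ((k : ℝ) + 1) : ℝ) * Complex.I)) (fun k l hkl => ?_)
    (fun k => Complex.norm_exp_ofReal_mul_I _)
  have hb : ∀ k : ℕ, -Real.pi < 1 / ((k : ℝ) + 1) ∧ 1 / ((k : ℝ) + 1) ≤ Real.pi := fun k => by
    have h0 : 0 < 1 / ((k : ℝ) + 1) := Nat.one_div_pos_of_nat
    have h1 : 1 / ((k : ℝ) + 1) ≤ 1 := by
      rw [div_le_one (by positivity)]
      linarith [(Nat.cast_nonneg k : (0 : ℝ) ≤ k)]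
    have := Real.pi_gt_three
    constructor <;> linarith
  have him : ∀ r : ℝ, ((r : ℂ) * Complex.I).im = r := fun r => by
    rw [Complex.im_ofReal_mul, Complex.I_im, mul_one]
  have h := Complex.exp_inj_of_neg_pi_lt_of_le_pi (by rw [him]; exact (hb k).1)
    (by rw [him]; exact (hb k).2) (by rw [him]; exact (hb l).1) (by rw [him]; exact (hb l).2) hkl
  have h2 := mul_right_cancel₀ Complex.I_ne_zero h
  have h3 : (1 / ((k : ℝ) + 1) : ℝ) = 1 / ((l : ℝ) + 1) := by exact_mod_cast h2
  have h4 : ((k : ℝ) + 1) = (l : ℝ) + 1 := by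
    simpa using h3
  exact_mod_cast add_right_cancel h4

/-! ### The pencil UΔ − Γ and pairs of commuting isometries. -/

/-- The diagonal of `Δ` for blocks labelled by `κ`. -/
def diagDelta {ι R : Type*} [One R] (κ : ι → Fin 3) (z w : R) : ι → R := fun i => ![w, z, 1] (κ i)

/-- The diagonal of `Γ` for blocks labelled by `κ`. -/
def diagGamma {ι R : Type*} [One R] (κ : ι → Fin 3) (z : R) : ι → R := fun i => ![1, 1, z] (κ i)

/-- The matrix `UΔ - Γ` for blocks labelled by `κ`. -/
def pencil {ι R : Type*} [Fintype ι] [DecidableEq ι] [CommRing R] [Algebra ℂ R]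
    (U : Matrix ι ι ℂ) (κ : ι → Fin 3) (z w : R) : Matrix ι ι R :=
  U.map (algebraMap ℂ R) * Matrix.diagonal (diagDelta κ z w) - Matrix.diagonal (diagGamma κ z)

/-- The labelling of three consecutive blocks. -/
def blockLabel (α β γ : Type*) : α ⊕ (β ⊕ γ) → Fin 3 :=
  Sum.elim (fun _ => 0) (Sum.elim (fun _ => 1) (fun _ => 2))

section Hilbert

variable {K : Type*} [NormedAddCommGroup K] [InnerProductSpace ℂ K]

/-- For the component r of x in Nᗮ, the vector Zr − ar lies in N and is orthogonal to ar. Pythagoras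
gives ‖r‖ = ‖Zr‖ ≥ |a|‖r‖, hence r = 0. This allows division by z − a when a lies outside the closed
disk. -/
theorem mem_of_isometry_sub_smul_mem (Z : K →ₗᵢ[ℂ] K) (N : Submodule ℂ K)
    [N.HasOrthogonalProjection] (hN : N.map Z.toLinearMap ≤ N) {a : ℂ} (ha : 1 < ‖a‖) {x : K}
    (hx : Z x - a • x ∈ N) : x ∈ N := by
  set n := N.starProjection x with hn
  set r := x - n with hr
  have hnN : n ∈ N := Submodule.starProjection_apply_mem N x
  have hrN : r ∈ Nᗮ := Submodule.sub_starProjection_mem_orthogonal x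
  have h1 : Z r - a • r ∈ N := by
    have h2 : Z n - a • n ∈ N :=
      N.sub_mem (hN ⟨n, hnN, rfl⟩) (N.smul_mem a hnN)
    have h3 : Z r - a • r = (Z x - a • x) - (Z n - a • n) := by
      rw [hr, map_sub, smul_sub]; abel
    rw [h3]
    exact N.sub_mem hx h2
  have h4 : ‖Z r‖ * ‖Z r‖ = ‖Z r - a • r‖ * ‖Z r - a • r‖ + ‖a • r‖ * ‖a • r‖ := by
    rw [← norm_add_sq_eq_norm_sq_add_norm_sq_of_inner_eq_zero (𝕜 := ℂ) _ _
      (Submodule.smul_mem _ a hrN _ h1)]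
    congr 1 <;> congr 1 <;> abel
  rw [Z.norm_map, norm_smul] at h4
  have h5 : ‖r‖ = 0 := by
    by_contra hne
    have hpos : 0 < ‖r‖ := lt_of_le_of_ne (norm_nonneg r) (Ne.symm hne)
    nlinarith [mul_self_nonneg ‖Z r - a • r‖, mul_pos hpos hpos,
      mul_lt_mul_of_pos_right ha hpos, mul_self_lt_mul_self hpos.le
        (show ‖r‖ < ‖a‖ * ‖r‖ by nlinarith)]
  have h6 : x = n := sub_eq_zero.1 (norm_eq_zero.1 h5)
  rw [h6]
  exact hnN

/-- The projection to Nᗮ composed with ι factors through φ, so its range is finite-dimensional and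
therefore closed; by density it contains all of Nᗮ ⊓ H. -/
theorem finiteDimensional_orthogonal_inf {A V : Type*} [AddCommGroup A] [Module ℂ A]
    [AddCommGroup V] [Module ℂ V] [FiniteDimensional ℂ V] (ι : A →ₗ[ℂ] K) (φ : A →ₗ[ℂ] V)
    (N H : Submodule ℂ K) [N.HasOrthogonalProjection]
    (hH : H ≤ (LinearMap.range ι).topologicalClosure) (h : ∀ a, φ a = 0 → ι a ∈ N) :
    FiniteDimensional ℂ ↥(Nᗮ ⊓ H) ∧ Module.finrank ℂ ↥(Nᗮ ⊓ H) ≤ Module.finrank ℂ V := by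
  let Q : K →L[ℂ] K := Nᗮ.starProjection
  let L : A →ₗ[ℂ] K := Q.toLinearMap.comp ι
  have hker : φ.ker ≤ L.ker := fun a ha => by
    rw [LinearMap.mem_ker] at ha ⊢
    have : ι a ∈ Nᗮᗮ := Submodule.le_orthogonal_orthogonal N (h a ha)
    exact (Submodule.starProjection_apply_eq_zero_iff _).2 this
  let L' : φ.range →ₗ[ℂ] K :=
    (φ.ker.liftQ L hker).comp φ.quotKerEquivRange.symm.toLinearMap
  have hL' : L.range ≤ L'.range := by
    rintro _ ⟨a, rfl⟩
    refine ⟨⟨φ a, a, rfl⟩, ?_⟩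
    have : φ.quotKerEquivRange.symm ⟨φ a, a, rfl⟩ = Submodule.Quotient.mk a := by
      rw [LinearEquiv.symm_apply_eq]; rfl
    simp [L', this]
  have hle : Nᗮ ⊓ H ≤ L'.range := by
    rintro x ⟨hx1, hx2⟩
    have hclosed : IsClosed (L'.range : Set K) := Submodule.closed_of_finiteDimensional _
    have h1 : Q x = x := Submodule.starProjection_eq_self_iff.2 hx1
    have h2 : Q x ∈ closure (Q '' (LinearMap.range ι : Set K)) :=
      image_closure_subset_closure_image Q.continuous ⟨x, hH hx2, rfl⟩
    rw [← h1]
    refine (closure_minimal ?_ hclosed) h2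
    rintro _ ⟨_, ⟨a, rfl⟩, rfl⟩
    exact hL' ⟨a, rfl⟩
  have hfd : FiniteDimensional ℂ ↥(Nᗮ ⊓ H) := Submodule.finiteDimensional_of_le hle
  exact ⟨hfd, (Submodule.finrank_mono hle).trans
    ((LinearMap.finrank_range_le L').trans (Submodule.finrank_le _))⟩

theorem finiteDimensional_orthogonal_inf_of_map {A V : Type*} [AddCommGroup A] [Module ℂ A]
    [AddCommGroup V] [Module ℂ V] [FiniteDimensional ℂ V] (ι : A →ₗ[ℂ] K) (D : Submodule ℂ A)
    (φ : A →ₗ[ℂ] V) (N : Submodule ℂ K) [N.HasOrthogonalProjection]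
    (h : ∀ a ∈ D, φ a = 0 → ι a ∈ N) :
    FiniteDimensional ℂ ↥(Nᗮ ⊓ (D.map ι).topologicalClosure) ∧
      Module.finrank ℂ ↥(Nᗮ ⊓ (D.map ι).topologicalClosure) ≤ Module.finrank ℂ V := by
  refine finiteDimensional_orthogonal_inf (ι ∘ₗ D.subtype) (φ ∘ₗ D.subtype) N _ ?_
    fun a ha => h a.1 a.2 ha
  rw [LinearMap.range_comp, Submodule.range_subtype]

theorem IsOrthoDiffBasis.mem {ι : Type*} {ε : ι → K} {M N : Submodule ℂ K}
    (h : IsOrthoDiffBasis ε M N) (i : ι) : ε i ∈ Mᗮ ⊓ N :=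
  h.2 ▸ Submodule.subset_span ⟨i, rfl⟩

/-- The data extracted from two commuting isometries `Z`, `W` on nested subspaces `H ≤ H'`. -/
structure IsometryModel (Z W : K →ₗᵢ[ℂ] K) (H H' : Submodule ℂ K) : Prop where
  comm : ∀ x, Z (W x) = W (Z x)
  closed : IsClosed (H : Set K)
  closed' : IsClosed (H' : Set K)
  le : H ≤ H'
  map_W_le : H.map W.toLinearMap ≤ H'
  map_Z_le : H.map Z.toLinearMap ≤ H
  le_closure : H' ≤ (H ⊔ H.map W.toLinearMap).topologicalClosure

variable [CompleteSpace K] {Z W : K →ₗᵢ[ℂ] K} {H H' : Submodule ℂ K}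

/-- Writing P_M for the projection onto M, the frame operators of both families telescope to P_{H'}
+ P_{ZH'} − P_{ZH} − P_{ZWH}; commutation enters as WZH = ZWH. -/
theorem IsometryModel.exists_unitary (hM : IsometryModel Z W H H')
    {α β γ : Type*} [Fintype α] [Fintype β] [Fintype γ] [DecidableEq α] [DecidableEq β]
    [DecidableEq γ] {ε : α → K} {φ : β → K} {g : γ → K}
    (hε : IsOrthoDiffBasis ε (H.map Z.toLinearMap) H)
    (hφ : IsOrthoDiffBasis φ H H')
    (hg : IsOrthoDiffBasis g (H.map W.toLinearMap) H') :
    ∃ V ∈ Matrix.unitaryGroup (α ⊕ (β ⊕ γ)) ℂ, ∀ i,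
      Sum.elim ε (Sum.elim φ (Z ∘ g)) i =
        ∑ k, V i k • Sum.elim (W ∘ ε) (Sum.elim (Z ∘ φ) g) k := by
  have := hM.closed.completeSpace_coe
  have := hM.closed'.completeSpace_coe
  have hcl : ∀ (T : K →ₗᵢ[ℂ] K) (N : Submodule ℂ K) [CompleteSpace N],
      CompleteSpace (N.map T.toLinearMap) := fun T N _ => T.completeSpace_map N
  have := hcl Z H
  have := hcl W H
  have := hcl Z H'
  have := hcl Z (H.map W.toLinearMap)
  have := hcl W (H.map Z.toLinearMap)
  refine exists_unitary_of_sum_norm_inner_sq_eq _ _ fun x => ?_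
  simp only [Fintype.sum_sum_type, Sum.elim_inl, Sum.elim_inr]
  have hZW : (H.map Z.toLinearMap).map W.toLinearMap = (H.map W.toLinearMap).map Z.toLinearMap := by
    ext y
    constructor
    · rintro ⟨_, ⟨x, hx, rfl⟩, rfl⟩
      exact ⟨W x, ⟨x, hx, rfl⟩, hM.comm x⟩
    · rintro ⟨_, ⟨x, hx, rfl⟩, rfl⟩
      exact ⟨Z x, ⟨x, hx, rfl⟩, (hM.comm x).symm⟩
  rw [(hε.map W).sum_norm_inner_sq (Submodule.map_mono hM.map_Z_le),
    (hφ.map Z).sum_norm_inner_sq (Submodule.map_mono hM.le),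
    hg.sum_norm_inner_sq hM.map_W_le, hε.sum_norm_inner_sq hM.map_Z_le,
    hφ.sum_norm_inner_sq hM.le, (hg.map Z).sum_norm_inner_sq (Submodule.map_mono hM.map_W_le)]
  simp_rw [hZW]
  ring

theorem IsometryModel.eq_zero_of_orthogonal (hM : IsometryModel Z W H H') {x : K}
    (hx : x ∈ H') (h1 : x ∈ Hᗮ) (h2 : x ∈ (H.map W.toLinearMap)ᗮ) : x = 0 := by
  have h3 : x ∈ (H ⊔ H.map W.toLinearMap)ᗮ := by
    rw [← Submodule.inf_orthogonal]; exact ⟨h1, h2⟩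
  have h4 := hM.le_closure hx
  rw [← Submodule.orthogonal_orthogonal_eq_closure] at h4
  exact inner_self_eq_zero.1 (h4 x h3)

/-- At w = 0 and |z| = 1, a left null vector of the pencil produces an eigenvector of Z with
eigenvalue z inside the span of φ and g. That span is finite-dimensional, so this cannot happen for
every z on the circle. -/
theorem IsometryModel.exists_det_pencil_ne_zero (hM : IsometryModel Z W H H')
    {α β γ : Type*} [Fintype α] [Fintype β] [Fintype γ] [DecidableEq α] [DecidableEq β]
    [DecidableEq γ] {ε : α → K} {φ : β → K} {g : γ → K}
    (hφ : IsOrthoDiffBasis φ H H')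
    (hg : IsOrthoDiffBasis g (H.map W.toLinearMap) H')
    {V : Matrix (α ⊕ (β ⊕ γ)) (α ⊕ (β ⊕ γ)) ℂ} (hV : V ∈ Matrix.unitaryGroup _ ℂ)
    (hVeq : ∀ i, Sum.elim ε (Sum.elim φ (Z ∘ g)) i =
        ∑ k, V i k • Sum.elim (W ∘ ε) (Sum.elim (Z ∘ φ) g) k) :
    ∃ z : ℂ, (pencil V (blockLabel α β γ) z (0 : ℂ)).det ≠ 0 := by
  by_contra! hcon
  let X : Submodule ℂ K := Submodule.span ℂ (Set.range φ) ⊔ Submodule.span ℂ (Set.range g)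
  have key : ∀ z : {z : ℂ | ‖z‖ = 1}, ∃ u ∈ X, u ≠ 0 ∧ Z u = (z : ℂ) • u := by
    rintro ⟨z, hz⟩
    have hz : ‖z‖ = 1 := hz
    have hz0 : z ≠ 0 := by rintro rfl; simp at hz
    obtain ⟨y, hy0, hy⟩ := Matrix.exists_vecMul_eq_zero_iff.2 (hcon z)
    set t := Matrix.vecMul y V with ht
    have hsum : ∑ i, y i • Sum.elim ε (Sum.elim φ (Z ∘ g)) i =
        ∑ k, t k • Sum.elim (W ∘ ε) (Sum.elim (Z ∘ φ) g) k := by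
      simp_rw [hVeq, Finset.smul_sum, smul_smul]
      rw [Finset.sum_comm]
      simp_rw [← Finset.sum_smul]
      rfl
    have hyt : ∀ i, t i * diagDelta (blockLabel α β γ) z 0 i =
        y i * diagGamma (blockLabel α β γ) z i := fun i => by
      have h1 := congrFun hy i
      have h2 : V.map (algebraMap ℂ ℂ) = V := by ext; simp
      rw [pencil, h2, Matrix.vecMul_sub, ← Matrix.vecMul_vecMul, ← ht, Pi.sub_apply,
        Matrix.vecMul_diagonal, Matrix.vecMul_diagonal, Pi.zero_apply, sub_eq_zero] at h1
      exact h1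
    have hnorm : ∑ i, ‖t i‖ ^ 2 = ∑ i, ‖y i‖ ^ 2 := by
      have h1 : t ⬝ᵥ star t = y ⬝ᵥ star y := by
        rw [ht, Matrix.star_vecMul, ← Matrix.dotProduct_mulVec, Matrix.mulVec_mulVec,
          ← Matrix.star_eq_conjTranspose, Matrix.mem_unitaryGroup_iff.1 hV, Matrix.one_mulVec]
      simp only [dotProduct, Pi.star_apply, RCLike.star_def, Complex.mul_conj,
        Complex.normSq_eq_norm_sq] at h1
      exact_mod_cast h1
    have hy1 : ∀ i, y (Sum.inl i) = 0 := fun i => by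
      simpa [diagDelta, diagGamma, blockLabel] using (hyt (Sum.inl i)).symm
    have hy2 : ∀ i, t (Sum.inr (Sum.inl i)) * z = y (Sum.inr (Sum.inl i)) := fun i => by
      simpa [diagDelta, diagGamma, blockLabel] using hyt (Sum.inr (Sum.inl i))
    have hy3 : ∀ i, t (Sum.inr (Sum.inr i)) = y (Sum.inr (Sum.inr i)) * z := fun i => by
      simpa [diagDelta, diagGamma, blockLabel] using hyt (Sum.inr (Sum.inr i))
    -- Unitarity gives ‖t‖ = ‖y‖, and the last two blocks have equal norms because |z| = 1; since y
    -- vanishes on the first block, so does t.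
    have ht1 : ∀ i, t (Sum.inl i) = 0 := fun i => by
      simp only [Fintype.sum_sum_type, hy1, ← hy2, hy3, norm_mul, hz, mul_one, norm_zero] at hnorm
      have h1 : ∑ i, ‖t (Sum.inl i)‖ ^ 2 = 0 := by
        simpa using hnorm
      have h2 := (Finset.sum_eq_zero_iff_of_nonneg (fun i _ => sq_nonneg _)).1 h1 i
        (Finset.mem_univ i)
      simpa using h2
    set f := ∑ i, t (Sum.inr (Sum.inl i)) • φ i with hf
    set h := ∑ i, y (Sum.inr (Sum.inr i)) • g i with hh
    have hrel : z • f + Z h = Z f + z • h := by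
      simp only [Fintype.sum_sum_type, Sum.elim_inl, Sum.elim_inr, hy1, ht1, zero_smul,
        Finset.sum_const_zero, zero_add, ← hy2, hy3, Function.comp] at hsum
      rw [hf, hh, map_sum, map_sum, Finset.smul_sum, Finset.smul_sum]
      simp only [map_smul, smul_smul, mul_comm z]
      exact hsum
    have hfX : f ∈ Submodule.span ℂ (Set.range φ) :=
      Submodule.sum_mem _ fun i _ => Submodule.smul_mem _ _ (Submodule.subset_span ⟨i, rfl⟩)
    have hhX : h ∈ Submodule.span ℂ (Set.range g) :=
      Submodule.sum_mem _ fun i _ => Submodule.smul_mem _ _ (Submodule.subset_span ⟨i, rfl⟩)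
    refine ⟨f - h, X.sub_mem (Submodule.mem_sup_left hfX) (Submodule.mem_sup_right hhX), ?_, ?_⟩
    -- A common value f = h lies in H' and is orthogonal to both H and WH, which together are dense
    -- in H'.
    · intro h0
      have hfh : f = h := sub_eq_zero.1 h0
      have hf0 : f = 0 := by
        have m1 := hfX
        have m2 := hhX
        rw [hφ.2] at m1
        rw [hg.2, ← hfh] at m2
        exact hM.eq_zero_of_orthogonal m1.2 m1.1 m2.1
      have hh0 : h = 0 := hfh ▸ hf0
      have e2 := Fintype.linearIndependent_iff.1 hφ.1.linearIndependent _ hf0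
      have e3 := Fintype.linearIndependent_iff.1 hg.1.linearIndependent _ hh0
      refine hy0 (funext fun i => ?_)
      rcases i with i | i | i
      · exact hy1 i
      · rw [← hy2, e2 i, zero_mul]; rfl
      · exact e3 i
    · rw [map_sub, smul_sub, sub_eq_sub_iff_add_eq_add, ← hrel]
  choose u huX hu0 hZu using key
  have hli := Module.End.eigenvectors_linearIndependent Z.toLinearMap {z : ℂ | ‖z‖ = 1} u
    (fun z => ⟨Module.End.mem_eigenspace_iff.2 (hZu z), hu0 z⟩)
  have hli2 : LinearIndependent ℂ (fun z => (⟨u z, huX z⟩ : X)) :=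
    LinearIndependent.of_comp X.subtype hli
  have : FiniteDimensional ℂ (Submodule.span ℂ (Set.range φ)) :=
    FiniteDimensional.span_of_finite ℂ (Set.finite_range φ)
  have : FiniteDimensional ℂ (Submodule.span ℂ (Set.range g)) :=
    FiniteDimensional.span_of_finite ℂ (Set.finite_range g)
  exact Complex.infinite_sphere (Set.finite_coe_iff.1 hli2.finite)

/-- Applying `ev` to the relation between the two families turns Z and W into the scalars z and w,
so the values of `ev` on (ε, φ, g) form a null vector; what needs proof is that it is nonzero. -/
theorem IsometryModel.det_pencil_eq_zero (hM : IsometryModel Z W H H')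
    {α β γ : Type*} [Fintype α] [Fintype β] [Fintype γ] [DecidableEq α] [DecidableEq β]
    [DecidableEq γ] {ε : α → K} {φ : β → K} {g : γ → K}
    (hε : IsOrthoDiffBasis ε (H.map Z.toLinearMap) H)
    (hφ : IsOrthoDiffBasis φ H H')
    (hg : IsOrthoDiffBasis g (H.map W.toLinearMap) H')
    {V : Matrix (α ⊕ (β ⊕ γ)) (α ⊕ (β ⊕ γ)) ℂ}
    (hVeq : ∀ i, Sum.elim ε (Sum.elim φ (Z ∘ g)) i =
        ∑ k, V i k • Sum.elim (W ∘ ε) (Sum.elim (Z ∘ φ) g) k)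
    (ev : K →L[ℂ] ℂ) {z w : ℂ} (hz : ‖z‖ < 1) (hevZ : ∀ x ∈ H', ev (Z x) = z * ev x)
    (hevW : ∀ x ∈ H, ev (W x) = w * ev x) {x₀ : K} (hx₀ : x₀ ∈ H) (hev : ev x₀ ≠ 0) :
    (pencil V (blockLabel α β γ) z w).det = 0 := by
  rw [← Matrix.exists_mulVec_eq_zero_iff]
  refine ⟨fun i => ev (Sum.elim ε (Sum.elim φ g) i), fun h0 => ?_, ?_⟩
  · have := hM.closed.completeSpace_coe
    have : CompleteSpace (H.map Z.toLinearMap) := Z.completeSpace_map H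
    have hε0 : ∀ x ∈ (H.map Z.toLinearMap)ᗮ ⊓ H, ev x = 0 := by
      rw [← hε.2]
      intro x hx
      induction hx using Submodule.span_induction with
      | mem x hx => obtain ⟨i, rfl⟩ := hx; exact congrFun h0 (Sum.inl i)
      | zero => exact map_zero ev
      | add x y _ _ hx hy => rw [map_add, hx, hy, add_zero]
      | smul c x _ hx => rw [map_smul, hx, smul_zero]
    -- If `ev` kills H ⊖ ZH, only the component Zy of x in ZH contributes. Iterating gains a factor
    -- |z| < 1 each time and forces `ev` to vanish on H, contrary to `hev`.
    have hstep : ∀ x ∈ H, ∃ y ∈ H, ‖y‖ ≤ ‖x‖ ∧ ev x = z * ev y := by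
      intro x hx
      obtain ⟨y, hy, hyx⟩ := Submodule.starProjection_apply_mem (H.map Z.toLinearMap) x
      refine ⟨y, hy, ?_, ?_⟩
      · rw [← Z.norm_map y]
        change ‖Z.toLinearMap y‖ ≤ _
        rw [hyx]
        exact Submodule.norm_starProjection_apply_le _ x
      · have h1 : ev (x - (H.map Z.toLinearMap).starProjection x) = 0 :=
          hε0 _ ⟨Submodule.sub_starProjection_mem_orthogonal x,
            H.sub_mem hx (hM.map_Z_le (Submodule.starProjection_apply_mem _ x))⟩
        rw [map_sub, sub_eq_zero] at h1
        rw [h1, ← hyx]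
        exact hevZ y (hM.le hy)
    have hiter : ∀ k : ℕ, ∀ x ∈ H, ‖ev x‖ ≤ ‖z‖ ^ k * (‖ev‖ * ‖x‖) := by
      intro k
      induction k with
      | zero => intro x _; simpa using ev.le_opNorm x
      | succ k ih =>
        intro x hx
        obtain ⟨y, hy, hyx, he⟩ := hstep x hx
        rw [he, norm_mul, pow_succ', mul_assoc]
        gcongr
        exact (ih y hy).trans (by gcongr)
    have hlim : Filter.Tendsto (fun k : ℕ => ‖z‖ ^ k * (‖ev‖ * ‖x₀‖)) Filter.atTop (nhds 0) := by
      simpa using (tendsto_pow_atTop_nhds_zero_of_lt_one (norm_nonneg z) hz).mul_const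
        (‖ev‖ * ‖x₀‖)
    have h2 : ‖ev x₀‖ ≤ 0 := ge_of_tendsto' hlim fun k => hiter k x₀ hx₀
    exact hev (norm_le_zero_iff.1 h2)
  · funext i
    have h1 : V.map (algebraMap ℂ ℂ) = V := by ext; simp
    rw [pencil, h1, Matrix.sub_mulVec, ← Matrix.mulVec_mulVec, Pi.sub_apply, Pi.zero_apply,
      Matrix.mulVec_diagonal, sub_eq_zero]
    have hsrc : ∀ k, ev (Sum.elim (W ∘ ε) (Sum.elim (Z ∘ φ) g) k) =
        (Matrix.diagonal (diagDelta (blockLabel α β γ) z w)).mulVec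
          (fun i => ev (Sum.elim ε (Sum.elim φ g) i)) k := by
      intro k
      rw [Matrix.mulVec_diagonal]
      rcases k with k | k | k
      · simpa [diagDelta, blockLabel] using hevW _ (hε.mem k).2
      · simpa [diagDelta, blockLabel] using hevZ _ (hφ.mem k).2
      · simp [diagDelta, blockLabel]
    have htgt : ev (Sum.elim ε (Sum.elim φ (Z ∘ g)) i) =
        diagGamma (blockLabel α β γ) z i * ev (Sum.elim ε (Sum.elim φ g) i) := by
      rcases i with i | i | i
      · simp [diagGamma, blockLabel]
      · simp [diagGamma, blockLabel]
      · simpa [diagGamma, blockLabel] using hevZ _ (hg.mem i).2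
    rw [← htgt, hVeq i, map_sum]
    refine Finset.sum_congr rfl fun k _ => ?_
    rw [map_smul, hsrc k]
    rfl

end Hilbert

/-! ### Hilbert space of a semidefinite form, and extension of maps to it. -/

section GNS

/-- A positive semidefinite form is realised by a linear map with dense range into a
Hilbert space. -/
theorem PreInnerProductSpace.Core.exists_hilbert {V : Type} [AddCommGroup V] [Module ℂ V]
    (c : PreInnerProductSpace.Core ℂ V) :
    ∃ (K : Type) (_ : NormedAddCommGroup K) (_ : InnerProductSpace ℂ K) (_ : CompleteSpace K)
      (ι : V →ₗ[ℂ] K), DenseRange ι ∧ ∀ x y, ⟪ι x, ι y⟫_ℂ = c.inner x y := by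
  let _ : SeminormedAddCommGroup V := InnerProductSpace.Core.toSeminormedAddCommGroup (c := c)
  let _ : InnerProductSpace ℂ V := InnerProductSpace.ofCore c
  refine ⟨UniformSpace.Completion V, inferInstance, inferInstance, inferInstance,
    (UniformSpace.Completion.toComplₗᵢ (𝕜 := ℂ) (E := V)).toLinearMap,
    UniformSpace.Completion.denseRange_coe (α := V), ?_⟩
  intro x y
  exact UniformSpace.Completion.inner_coe x y

variable {V : Type*} [AddCommGroup V] [Module ℂ V]
  {K : Type*} [NormedAddCommGroup K] [InnerProductSpace ℂ K]

theorem exists_linearIsometry_extending [CompleteSpace K] {ι : V →ₗ[ℂ] K} (hι : DenseRange ι) (T : V →ₗ[ℂ] V)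
    (hT : ∀ v, ‖ι (T v)‖ = ‖ι v‖) : ∃ Z : K →ₗᵢ[ℂ] K, ∀ v, Z (ι v) = ι (T v) := by
  have hb : ∃ C : ℝ, ∀ v, ‖(ι ∘ₗ T) v‖ ≤ C * ‖ι v‖ := ⟨1, fun v => by simp [hT]⟩
  let Z := (ι ∘ₗ T).extendOfNorm ι
  have hZ : ∀ v, Z (ι v) = ι (T v) := fun v => LinearMap.extendOfNorm_eq hι hb v
  refine ⟨⟨Z.toLinearMap, fun x => ?_⟩, hZ⟩
  refine hι.induction_on (p := fun x => ‖Z x‖ = ‖x‖) x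
    (isClosed_eq (by fun_prop) (by fun_prop)) fun v => ?_
  rw [hZ, hT]

theorem exists_functional_extending {A : Type*} [AddCommGroup A] [Module ℂ A]
    (ι : A →ₗ[ℂ] K) (l : A →ₗ[ℂ] ℂ) (C : ℝ) (h : ∀ a, ‖l a‖ ≤ C * ‖ι a‖) :
    ∃ ev : K →L[ℂ] ℂ, ∀ a, ev (ι a) = l a := by
  obtain ⟨ev, hev, -⟩ := exists_extension_norm_eq _ (l.compLeftInverse ι)
  exact ⟨ev, fun a => (hev ⟨ι a, a, rfl⟩).trans
    (LinearMap.compLeftInverse_apply_of_bdd _ _ ⟨C, h⟩ a _ rfl)⟩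

theorem exists_functional_extending_of_mem (ι : V →ₗ[ℂ] K) (D : Submodule ℂ V) (l : V →ₗ[ℂ] ℂ)
    (C : ℝ) (h : ∀ a ∈ D, ‖l a‖ ≤ C * ‖ι a‖) : ∃ ev : K →L[ℂ] ℂ, ∀ a ∈ D, ev (ι a) = l a := by
  obtain ⟨ev, hev⟩ := exists_functional_extending (ι ∘ₗ D.subtype) (l ∘ₗ D.subtype) C
    fun a => h a.1 a.2
  exact ⟨ev, fun a ha => hev ⟨a, ha⟩⟩

theorem Submodule.map_topologicalClosure_le_of_map_le (T : K →ₗᵢ[ℂ] K) {S S' : Submodule ℂ K}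
    (h : S.map T.toLinearMap ≤ S') :
    S.topologicalClosure.map T.toLinearMap ≤ S'.topologicalClosure := by
  rintro _ ⟨x, hx, rfl⟩
  have h1 : T x ∈ closure (T '' (S : Set K)) :=
    image_closure_subset_closure_image T.continuous ⟨x, hx, rfl⟩
  exact closure_mono (fun y hy => h hy) h1

end GNS

/-! ### Resultants and common zeros; in ℂ[X][X] the inner variable is z and the outer one is w. -/

open Polynomial

/-- By Gauss's lemma P stays irreducible over the fraction field and still does not divide r, so the
two become coprime there. -/
theorem Polynomial.resultant_ne_zero_of_irreducible (F : Type*) [Field F] [Algebra ℂ[X] F]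
    [IsFractionRing ℂ[X] F] {P r : ℂ[X][X]} (hP : Irreducible P)
    (hm : P.natDegree ≠ 0) (hr : ¬ P ∣ r) : resultant P r ≠ 0 := by
  have hprim : P.IsPrimitive := hP.isPrimitive hm
  have hinj : Function.Injective (algebraMap ℂ[X] F) := IsFractionRing.injective _ _
  have hPF : Irreducible (P.map (algebraMap ℂ[X] F)) :=
    hprim.irreducible_iff_irreducible_map_fraction_map.1 hP
  have hcop : IsCoprime (P.map (algebraMap ℂ[X] F)) (r.map (algebraMap ℂ[X] F)) :=
    (EuclideanDomain.dvd_or_coprime _ _ hPF).resolve_left fun h =>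
      hr ((hprim.dvd_iff_fraction_map_dvd_fraction_map F).2 h)
  intro h0
  have h1 : resultant (P.map (algebraMap ℂ[X] F)) (r.map (algebraMap ℂ[X] F)) = 0 := by
    have := resultant_map_map P r P.natDegree r.natDegree (algebraMap ℂ[X] F)
    rw [h0, map_zero] at this
    rw [← this, natDegree_map_eq_of_injective hinj, natDegree_map_eq_of_injective hinj]
  exact (resultant_eq_zero_iff.1 h1).2 hcop

theorem Polynomial.exists_C_eq_mul_add_mul_of_irreducible {P r : ℂ[X][X]} (hP : Irreducible P)
    (hm : P.natDegree ≠ 0) (hr : ¬ P ∣ r) :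
    ∃ D : ℂ[X], D ≠ 0 ∧ ∃ a b : ℂ[X][X], C D = P * a + r * b := by
  obtain ⟨a, b, -, -, hab⟩ := exists_mul_add_mul_eq_C_resultant P r le_rfl le_rfl (Or.inl hm)
  exact ⟨_, resultant_ne_zero_of_irreducible (FractionRing ℂ[X]) hP hm hr, a, b, hab.symm⟩

/-- If `r` vanishes at zeros of the irreducible polynomial `P` over infinitely many points,
then `P` divides `r`. -/
theorem Polynomial.dvd_of_infinite_common_zeros {P r : ℂ[X][X]} (hP : Irreducible P)
    (hm : P.natDegree ≠ 0) {S : Set ℂ} (hS : S.Infinite)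
    (h : ∀ z ∈ S, ∃ w, P.evalEval z w = 0 ∧ r.evalEval z w = 0) : P ∣ r := by
  by_contra hr
  obtain ⟨D, hD, a, b, hab⟩ := exists_C_eq_mul_add_mul_of_irreducible hP hm hr
  refine hD (eq_zero_of_infinite_isRoot D (hS.mono fun z hz => ?_))
  obtain ⟨w, h1, h2⟩ := h z hz
  have h3 := congrArg (evalEval z w) hab
  rw [evalEval_C, evalEval_add, evalEval_mul, evalEval_mul, h1, h2, zero_mul, zero_mul,
    add_zero] at h3
  exact h3

theorem Polynomial.exists_norm_evalEval_le (r : ℝ) (f : ℂ[X][X]) :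
    ∃ C : ℝ, ∀ z w : ℂ, ‖z‖ ≤ r → ‖w‖ ≤ r → ‖f.evalEval z w‖ ≤ C := by
  have h1 : Continuous fun x : ℂ × ℂ => f.evalEval x.1 x.2 := by
    simp only [evalEval, eval_eq_sum_range (p := f), eval_finsetSum, eval_mul, eval_pow, eval_C]
    fun_prop
  obtain ⟨C, hC⟩ := ((isCompact_closedBall (0 : ℂ) r).prod
    (isCompact_closedBall (0 : ℂ) r)).exists_bound_of_continuousOn h1.continuousOn
  exact ⟨C, fun z w hz hw => hC (z, w) ⟨by simpa using hz, by simpa using hw⟩⟩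

/-- The one-variable polynomial obtained by fixing the inner variable. -/
noncomputable def Polynomial.fiber (P : ℂ[X][X]) (z : ℂ) : ℂ[X] := P.map (evalRingHom z)

theorem Polynomial.eval_fiber (P : ℂ[X][X]) (z w : ℂ) : (P.fiber z).eval w = P.evalEval z w := by
  rw [fiber, eval_map, eval₂_evalRingHom]

theorem Polynomial.coeff_fiber (P : ℂ[X][X]) (z : ℂ) (j : ℕ) :
    (P.fiber z).coeff j = (P.coeff j).eval z := by
  rw [fiber, coeff_map, coe_evalRingHom]

theorem Polynomial.natDegree_fiber (P : ℂ[X][X]) (z : ℂ) (hz : P.leadingCoeff.eval z ≠ 0) :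
    (P.fiber z).natDegree = P.natDegree :=
  natDegree_map_of_leadingCoeff_ne_zero _ hz

theorem Polynomial.card_roots_fiber_le (P : ℂ[X][X]) (z : ℂ) :
    Multiset.card (P.fiber z).roots ≤ P.natDegree :=
  (card_roots' _).trans natDegree_map_le

/-! ### Averages over the part of the curve above the unit circle. -/

open scoped ComplexConjugate
open Filter

/-- The average of `F` over the points of the curve `P = 0` above the `N`-th roots of unity. -/
noncomputable def rootMean (P : ℂ[X][X]) (F : ℂ → ℂ → ℂ) (N : ℕ) : ℂ :=
  (N : ℂ)⁻¹ * ∑ k ∈ Finset.range N,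
    ((P.fiber (Complex.exp (2 * Real.pi * Complex.I / N) ^ k)).roots.map
      (F (Complex.exp (2 * Real.pi * Complex.I / N) ^ k))).sum

theorem norm_exp_two_pi_div_pow (N k : ℕ) :
    ‖Complex.exp (2 * Real.pi * Complex.I / N) ^ k‖ = 1 := by
  have h : (2 * Real.pi * Complex.I / N : ℂ) = ((2 * Real.pi / N : ℝ) : ℂ) * Complex.I := by
    push_cast; ring
  rw [norm_pow, h, Complex.norm_exp_ofReal_mul_I, one_pow]

theorem evalEval_eq_zero_of_mem_roots_fiber {P : ℂ[X][X]} {z w : ℂ}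
    (h : w ∈ (P.fiber z).roots) : P.evalEval z w = 0 := by
  rw [← eval_fiber]
  exact isRoot_of_mem_roots h

theorem rootMean_congr {P : ℂ[X][X]} {F G : ℂ → ℂ → ℂ}
    (h : ∀ z w, ‖z‖ = 1 → P.evalEval z w = 0 → F z w = G z w) (N : ℕ) :
    rootMean P F N = rootMean P G N := by
  unfold rootMean
  congr 1
  refine Finset.sum_congr rfl fun k _ => ?_
  rw [Multiset.map_congr rfl fun w hw => h _ w (norm_exp_two_pi_div_pow N k)
    (evalEval_eq_zero_of_mem_roots_fiber hw)]

theorem rootMean_add (P : ℂ[X][X]) (F G : ℂ → ℂ → ℂ) (N : ℕ) :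
    rootMean P (fun z w => F z w + G z w) N = rootMean P F N + rootMean P G N := by
  simp only [rootMean, Multiset.sum_map_add, Finset.sum_add_distrib, mul_add]

theorem rootMean_mul_left (P : ℂ[X][X]) (c : ℂ) (F : ℂ → ℂ → ℂ) (N : ℕ) :
    rootMean P (fun z w => c * F z w) N = c * rootMean P F N := by
  simp only [rootMean, Multiset.sum_map_mul_left, ← Finset.mul_sum]
  ring

theorem rootMean_conj (P : ℂ[X][X]) (F : ℂ → ℂ → ℂ) (N : ℕ) :
    rootMean P (fun z w => conj (F z w)) N = conj (rootMean P F N) := by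
  simp only [rootMean, map_mul, map_inv₀, map_natCast, map_sum, map_multiset_sum,
    Multiset.map_map, Function.comp_def]

theorem rootMean_ofReal (P : ℂ[X][X]) (F : ℂ → ℂ → ℝ) (N : ℕ) :
    rootMean P (fun z w => (F z w : ℂ)) N = (((N : ℝ)⁻¹ * ∑ k ∈ Finset.range N,
    ((P.fiber (Complex.exp (2 * Real.pi * Complex.I / N) ^ k)).roots.map
      (F (Complex.exp (2 * Real.pi * Complex.I / N) ^ k))).sum : ℝ) : ℂ) := by
  unfold rootMean
  push_cast
  congr 1
  refine Finset.sum_congr rfl fun k _ => ?_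
  have := map_multiset_sum Complex.ofRealHom
    ((P.fiber (Complex.exp (2 * Real.pi * Complex.I / N) ^ k)).roots.map
      (F (Complex.exp (2 * Real.pi * Complex.I / N) ^ k)))
  rw [Multiset.map_map] at this
  exact this.symm

theorem norm_rootMean_le {P : ℂ[X][X]} {F : ℂ → ℂ → ℂ} {C : ℝ} (hC : 0 ≤ C)
    (h : ∀ z w, ‖z‖ = 1 → P.evalEval z w = 0 → ‖F z w‖ ≤ C) (N : ℕ) :
    ‖rootMean P F N‖ ≤ P.natDegree * C := by
  have h1 : ∀ k ∈ Finset.range N,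
      ‖((P.fiber (Complex.exp (2 * Real.pi * Complex.I / N) ^ k)).roots.map
      (F (Complex.exp (2 * Real.pi * Complex.I / N) ^ k))).sum‖ ≤ P.natDegree * C := by
    intro k _
    refine (norm_multiset_sum_le _).trans ?_
    rw [Multiset.map_map]
    refine (Multiset.sum_le_card_nsmul _ C ?_).trans ?_
    · intro x hx
      obtain ⟨w, hw, rfl⟩ := Multiset.mem_map.1 hx
      exact h _ w (norm_exp_two_pi_div_pow N k) (evalEval_eq_zero_of_mem_roots_fiber hw)
    · rw [Multiset.card_map, nsmul_eq_mul]
      gcongr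
      exact card_roots_fiber_le _ _
  rw [rootMean, norm_mul, norm_inv, Complex.norm_natCast]
  rcases Nat.eq_zero_or_pos N with rfl | hN
  · simp; positivity
  · rw [inv_mul_le_iff₀ (by exact_mod_cast hN)]
    refine (norm_sum_le_of_le _ h1).trans ?_
    rw [Finset.sum_const, Finset.card_range, nsmul_eq_mul]

/-- The limit of the averages `rootMean` along a nonprincipal ultrafilter. -/
noncomputable def rootLimit (P : ℂ[X][X]) (F : ℂ → ℂ → ℂ) : ℂ :=
  limUnder (hyperfilter ℕ : Filter ℕ) (rootMean P F)

/-- Boundedness alone gives a limit along an ultrafilter, so convergence of the averages to an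
integral never has to be shown. -/
theorem tendsto_rootLimit {P : ℂ[X][X]} {F : ℂ → ℂ → ℂ} {C : ℝ}
    (h : ∀ z w, ‖z‖ = 1 → P.evalEval z w = 0 → ‖F z w‖ ≤ C) :
    Tendsto (rootMean P F) (hyperfilter ℕ) (nhds (rootLimit P F)) := by
  have h0 : ∀ N, ‖rootMean P F N‖ ≤ P.natDegree * max C 0 := norm_rootMean_le (le_max_right _ _)
    fun z w hz hw => (h z w hz hw).trans (le_max_left _ _)
  obtain ⟨l, -, hl⟩ := (isCompact_closedBall (0 : ℂ)
    (P.natDegree * max C 0)).ultrafilter_le_nhds ((hyperfilter ℕ).map (rootMean P F))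
    (by
      rw [le_principal_iff]
      exact Filter.mem_map.2 (Filter.univ_mem' fun N => by simpa using h0 N))
  exact tendsto_nhds_limUnder ⟨l, hl⟩

section Form

variable {P : ℂ[X][X]}

theorem tendsto_rootLimit_inner (hT : ∀ z w : ℂ, ‖z‖ = 1 → P.evalEval z w = 0 → ‖w‖ = 1)
    (f g : ℂ[X][X]) :
    Tendsto (rootMean P fun z w => conj (f.evalEval z w) * g.evalEval z w) (hyperfilter ℕ)
      (nhds (rootLimit P fun z w => conj (f.evalEval z w) * g.evalEval z w)) := by
  obtain ⟨C, hC⟩ := exists_norm_evalEval_le 1 f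
  obtain ⟨C', hC'⟩ := exists_norm_evalEval_le 1 g
  refine tendsto_rootLimit (C := C * C') fun z w hz hw => ?_
  have hw' := hT z w hz hw
  rw [norm_mul, RCLike.norm_conj]
  exact mul_le_mul (hC z w hz.le hw'.le) (hC' z w hz.le hw'.le) (norm_nonneg _)
    ((norm_nonneg _).trans (hC z w hz.le hw'.le))

/-- The positive semidefinite form given by averaging over the curve `P = 0`. -/
@[reducible] noncomputable def curveForm (hT : ∀ z w : ℂ, ‖z‖ = 1 → P.evalEval z w = 0 → ‖w‖ = 1) :
    PreInnerProductSpace.Core ℂ ℂ[X][X] where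
  inner f g := rootLimit P fun z w => conj (f.evalEval z w) * g.evalEval z w
  conj_inner_symm f g := by
    refine tendsto_nhds_unique ?_ (tendsto_rootLimit_inner hT f g)
    have h1 := (Complex.continuous_conj.tendsto _).comp (tendsto_rootLimit_inner hT g f)
    refine h1.congr fun N => ?_
    rw [Function.comp, ← rootMean_conj]
    refine rootMean_congr (fun z w _ _ => ?_) N
    rw [map_mul, Complex.conj_conj, mul_comm]
  re_inner_nonneg f := by
    have h1 := (Complex.continuous_re.tendsto _).comp (tendsto_rootLimit_inner hT f f)
    refine ge_of_tendsto' h1 fun N => ?_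
    have h2 : rootMean P (fun z w => conj (f.evalEval z w) * f.evalEval z w) N =
        rootMean P (fun z w => ((‖f.evalEval z w‖ ^ 2 : ℝ) : ℂ)) N :=
      rootMean_congr (fun z w _ _ => by rw [Complex.conj_mul']; push_cast; rfl) N
    rw [Function.comp, h2, rootMean_ofReal, Complex.ofReal_re]
    refine mul_nonneg (by positivity) (Finset.sum_nonneg fun k _ => Multiset.sum_nonneg ?_)
    intro x hx
    obtain ⟨w, -, rfl⟩ := Multiset.mem_map.1 hx
    positivity
  add_left f g h := by
    refine tendsto_nhds_unique (tendsto_rootLimit_inner hT _ _) ?_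
    refine ((tendsto_rootLimit_inner hT f h).add (tendsto_rootLimit_inner hT g h)).congr
      fun N => ?_
    rw [← rootMean_add]
    refine rootMean_congr (fun z w _ _ => ?_) N
    rw [evalEval_add, map_add, add_mul]
  smul_left f g c := by
    refine tendsto_nhds_unique (tendsto_rootLimit_inner hT _ _) ?_
    refine ((tendsto_rootLimit_inner hT f g).const_mul (conj c)).congr fun N => ?_
    rw [← rootMean_mul_left]
    refine rootMean_congr (fun z w _ _ => ?_) N
    rw [evalEval_smul, smul_eq_mul, map_mul, mul_assoc]

theorem curveForm_inner_congr (hT : ∀ z w : ℂ, ‖z‖ = 1 → P.evalEval z w = 0 → ‖w‖ = 1)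
    {f g f' g' : ℂ[X][X]} (h : ∀ z w, ‖z‖ = 1 → P.evalEval z w = 0 →
      conj (f.evalEval z w) * g.evalEval z w = conj (f'.evalEval z w) * g'.evalEval z w) :
    (curveForm hT).inner f g = (curveForm hT).inner f' g' := by
  refine tendsto_nhds_unique (tendsto_rootLimit_inner hT f g) ?_
  exact (tendsto_rootLimit_inner hT f' g').congr fun N => (rootMean_congr h N).symm

theorem sum_exp_two_pi_div_pow {N : ℕ} (hN : 0 < N) {i j : ℕ} (hi : i < N) (hj : j < N) :
    ∑ k ∈ Finset.range N, (Complex.exp (2 * Real.pi * Complex.I / N) ^ k) ^ i *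
      ((Complex.exp (2 * Real.pi * Complex.I / N) ^ k)⁻¹) ^ j = if i = j then (N : ℂ) else 0 := by
  set ζ := Complex.exp (2 * Real.pi * Complex.I / N) with hζ
  have hprim : IsPrimitiveRoot ζ N := Complex.isPrimitiveRoot_exp N hN.ne'
  have h0 : ζ ≠ 0 := Complex.exp_ne_zero _
  have h1 : ∀ k, (ζ ^ k) ^ i * ((ζ ^ k)⁻¹) ^ j = (ζ ^ i * (ζ ^ j)⁻¹) ^ k := fun k => by
    rw [mul_pow, ← pow_mul, ← pow_mul, inv_pow, ← pow_mul, inv_pow, ← pow_mul, mul_comm k i,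
      mul_comm k j]
  simp_rw [h1]
  split_ifs with hij
  · subst hij
    rw [mul_inv_cancel₀ (pow_ne_zero _ h0)]
    simp
  · have hne : ζ ^ i * (ζ ^ j)⁻¹ ≠ 1 := fun h => by
      rw [mul_inv_eq_one₀ (pow_ne_zero _ h0)] at h
      exact hij (hprim.pow_inj hi hj h)
    rw [geom_sum_eq hne, mul_pow, inv_pow, ← pow_mul, ← pow_mul, mul_comm i, mul_comm j,
      pow_mul, pow_mul, hprim.pow_eq_one]
    simp

/-- A discrete Cauchy formula: for N > deg G, the value G(z) is exactly the mean over N-th roots of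
unity ζ of G(ζ) Σ_{j<N} (z/ζ)^j, and this kernel is bounded by the geometric series 1/(1 − |z|). -/
theorem Polynomial.norm_eval_le_mean_of_norm_lt_one (G : ℂ[X]) {z : ℂ} (hz : ‖z‖ < 1) {N : ℕ}
    (hN : G.natDegree < N) :
    ‖G.eval z‖ ≤ (1 - ‖z‖)⁻¹ * ((N : ℝ)⁻¹ * ∑ k ∈ Finset.range N,
      ‖G.eval (Complex.exp (2 * Real.pi * Complex.I / N) ^ k)‖) := by
  set ζ := Complex.exp (2 * Real.pi * Complex.I / N) with hζ
  have hN0 : 0 < N := by omega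
  have hNc : (N : ℂ) ≠ 0 := by exact_mod_cast hN0.ne'
  have h1 : G.eval z = (N : ℂ)⁻¹ * ∑ k ∈ Finset.range N, G.eval (ζ ^ k) *
      ∑ j ∈ Finset.range N, (z * (ζ ^ k)⁻¹) ^ j := by
    rw [eq_inv_mul_iff_mul_eq₀ hNc]
    symm
    calc ∑ k ∈ Finset.range N, G.eval (ζ ^ k) * ∑ j ∈ Finset.range N, (z * (ζ ^ k)⁻¹) ^ j
        = ∑ k ∈ Finset.range N, ∑ i ∈ Finset.range N, ∑ j ∈ Finset.range N,
            G.coeff i * z ^ j * ((ζ ^ k) ^ i * ((ζ ^ k)⁻¹) ^ j) := by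
          refine Finset.sum_congr rfl fun k _ => ?_
          rw [eval_eq_sum_range' hN, Finset.sum_mul]
          refine Finset.sum_congr rfl fun i _ => ?_
          rw [Finset.mul_sum]
          refine Finset.sum_congr rfl fun j _ => ?_
          rw [mul_pow]; ring
      _ = ∑ i ∈ Finset.range N, ∑ j ∈ Finset.range N, G.coeff i * z ^ j *
            ∑ k ∈ Finset.range N, ((ζ ^ k) ^ i * ((ζ ^ k)⁻¹) ^ j) := by
          rw [Finset.sum_comm]
          refine Finset.sum_congr rfl fun i _ => ?_
          rw [Finset.sum_comm]
          refine Finset.sum_congr rfl fun j _ => ?_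
          rw [Finset.mul_sum]
      _ = ∑ i ∈ Finset.range N, G.coeff i * z ^ i * N := by
          refine Finset.sum_congr rfl fun i hi => ?_
          rw [Finset.sum_eq_single_of_mem i hi]
          · rw [sum_exp_two_pi_div_pow hN0 (Finset.mem_range.1 hi) (Finset.mem_range.1 hi),
              if_pos rfl]
          · intro j hj hji
            rw [sum_exp_two_pi_div_pow hN0 (Finset.mem_range.1 hi) (Finset.mem_range.1 hj),
              if_neg (Ne.symm hji), mul_zero]
      _ = N * G.eval z := by
          rw [eval_eq_sum_range' hN, ← Finset.sum_mul, mul_comm]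
  have h2 : ∀ k, ‖∑ j ∈ Finset.range N, (z * (ζ ^ k)⁻¹) ^ j‖ ≤ (1 - ‖z‖)⁻¹ := fun k => by
    refine (norm_sum_le _ _).trans ?_
    have : ∀ j, ‖(z * (ζ ^ k)⁻¹) ^ j‖ = ‖z‖ ^ j := fun j => by
      rw [norm_pow, norm_mul, norm_inv, norm_exp_two_pi_div_pow, inv_one, mul_one]
    simp_rw [this]
    rw [← tsum_geometric_of_lt_one (norm_nonneg z) hz]
    exact (summable_geometric_of_lt_one (norm_nonneg z) hz).sum_le_tsum _
      fun j _ => by positivity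
  rw [h1, norm_mul, norm_inv, Complex.norm_natCast, mul_left_comm]
  gcongr
  refine (norm_sum_le _ _).trans ?_
  rw [Finset.mul_sum]
  refine Finset.sum_le_sum fun k _ => ?_
  rw [norm_mul, mul_comm]
  gcongr
  exact h2 k

variable {K : Type} [NormedAddCommGroup K] [InnerProductSpace ℂ K] {ι : ℂ[X][X] →ₗ[ℂ] K}

/-- The crude inequality t ≤ 1 + t² replaces Cauchy–Schwarz; the resulting bound is not homogeneous
in f, which rescaling repairs afterwards. -/
theorem norm_eval_le_of_dominated_aux
    (hT : ∀ z w : ℂ, ‖z‖ = 1 → P.evalEval z w = 0 → ‖w‖ = 1)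
    (hι : ∀ f g, ⟪ι f, ι g⟫_ℂ = (curveForm hT).inner f g) {f : ℂ[X][X]} {G : ℂ[X]} {B : ℝ}
    (hB : 0 ≤ B) (h : ∀ z : ℂ, ‖z‖ = 1 →
      ‖G.eval z‖ ≤ B * ((P.fiber z).roots.map fun w => ‖f.evalEval z w‖).sum)
    {z : ℂ} (hz : ‖z‖ < 1) :
    ‖G.eval z‖ ≤ (1 - ‖z‖)⁻¹ * (B * (P.natDegree + ‖ι f‖ ^ 2)) := by
  have hlim : Tendsto (fun N => (1 - ‖z‖)⁻¹ * (B * (P.natDegree +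
      (rootMean P (fun z w => conj (f.evalEval z w) * f.evalEval z w) N).re)))
      (hyperfilter ℕ) (nhds ((1 - ‖z‖)⁻¹ * (B * (P.natDegree + ‖ι f‖ ^ 2)))) := by
    have h1 : ‖ι f‖ ^ 2 = (rootLimit P fun z w => conj (f.evalEval z w) * f.evalEval z w).re := by
      rw [← inner_self_eq_norm_sq (𝕜 := ℂ), hι]
      rfl
    rw [h1]
    exact ((((Complex.continuous_re.tendsto _).comp
      (tendsto_rootLimit_inner hT f f)).const_add _).const_mul _).const_mul _
  refine ge_of_tendsto hlim ?_
  -- The discrete Cauchy formula needs N > deg G, which holds eventually along the nonprincipal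
  -- ultrafilter.
  refine Nat.hyperfilter_le_atTop (eventually_gt_atTop G.natDegree |>.mono fun N hN => ?_)
  have hN0 : (0 : ℝ) < N := by exact_mod_cast (by omega : 0 < N)
  refine (norm_eval_le_mean_of_norm_lt_one G hz hN).trans ?_
  have hz' : 0 < 1 - ‖z‖ := by linarith
  have h2 : rootMean P (fun z w => conj (f.evalEval z w) * f.evalEval z w) N =
      rootMean P (fun z w => ((‖f.evalEval z w‖ ^ 2 : ℝ) : ℂ)) N :=
    rootMean_congr (fun z w _ _ => by rw [Complex.conj_mul']; push_cast; rfl) N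
  rw [h2, rootMean_ofReal, Complex.ofReal_re]
  refine mul_le_mul_of_nonneg_left ?_ (inv_nonneg.2 hz'.le)
  have h3 : (P.natDegree : ℝ) = (N : ℝ)⁻¹ * ∑ k ∈ Finset.range N, (P.natDegree : ℝ) := by
    rw [Finset.sum_const, Finset.card_range, nsmul_eq_mul, inv_mul_cancel_left₀ hN0.ne']
  rw [h3, ← mul_add, ← Finset.sum_add_distrib, mul_left_comm, Finset.mul_sum _ _ B]
  refine mul_le_mul_of_nonneg_left (Finset.sum_le_sum fun k _ => ?_) (by positivity)
  refine (h _ (norm_exp_two_pi_div_pow N k)).trans (mul_le_mul_of_nonneg_left ?_ hB)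
  generalize Complex.exp (2 * Real.pi * Complex.I / N) ^ k = x
  have h4 : ((P.fiber x).roots.map fun w => ‖f.evalEval x w‖).sum ≤
      ((P.fiber x).roots.map fun w => 1 + ‖f.evalEval x w‖ ^ 2).sum :=
    Multiset.sum_map_le_sum_map _ _ fun w _ => by nlinarith [sq_nonneg (‖f.evalEval x w‖ - 1)]
  refine h4.trans ?_
  rw [Multiset.sum_map_add]
  gcongr
  rw [Multiset.map_const', Multiset.sum_replicate, nsmul_eq_mul, mul_one]
  exact_mod_cast card_roots_fiber_le P x

/-- Scaling f and G by t = 1/‖ι f‖ makes the previous bound linear in ‖ι f‖. When ‖ι f‖ = 0,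
arbitrarily large t force G(z) = 0. -/
theorem norm_eval_le_of_dominated
    (hT : ∀ z w : ℂ, ‖z‖ = 1 → P.evalEval z w = 0 → ‖w‖ = 1)
    (hι : ∀ f g, ⟪ι f, ι g⟫_ℂ = (curveForm hT).inner f g) {f : ℂ[X][X]} {G : ℂ[X]} {B : ℝ}
    (hB : 0 ≤ B) (h : ∀ z : ℂ, ‖z‖ = 1 →
      ‖G.eval z‖ ≤ B * ((P.fiber z).roots.map fun w => ‖f.evalEval z w‖).sum)
    {z : ℂ} (hz : ‖z‖ < 1) :
    ‖G.eval z‖ ≤ (1 - ‖z‖)⁻¹ * B * (P.natDegree + 1) * ‖ι f‖ := by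
  have key : ∀ t : ℝ, 0 < t →
      t * ‖G.eval z‖ ≤ (1 - ‖z‖)⁻¹ * (B * (P.natDegree + t ^ 2 * ‖ι f‖ ^ 2)) := by
    intro t ht
    have h1 := norm_eval_le_of_dominated_aux hT hι (f := (t : ℂ) • f) (G := (t : ℂ) • G) hB
      (fun x hx => ?_) hz
    · simpa [norm_smul, mul_pow, abs_of_pos ht] using h1
    · have h2 : ∀ w, ‖((t : ℂ) • f).evalEval x w‖ = t * ‖f.evalEval x w‖ := fun w => by
        rw [evalEval_smul, norm_smul, Complex.norm_real, Real.norm_of_nonneg ht.le]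
      simp_rw [h2]
      rw [Multiset.sum_map_mul_left, mul_left_comm, eval_smul, norm_smul, Complex.norm_real,
        Real.norm_of_nonneg ht.le]
      exact mul_le_mul_of_nonneg_left (h x hx) ht.le
  have hz' : 0 < 1 - ‖z‖ := by linarith
  rcases (norm_nonneg (ι f)).eq_or_lt with h0 | h0
  · rw [← h0, mul_zero]
    by_contra! hpos
    set A := (1 - ‖z‖)⁻¹ * (B * P.natDegree) with hA
    have hA0 : 0 ≤ A := by positivity
    -- This t makes the left side of `key` equal to A + 1, while the right side is A.
    have h1 := key ((A + 1) / ‖G.eval z‖) (by positivity)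
    rw [← h0, div_mul_cancel₀ _ hpos.ne'] at h1
    simp only [ne_eq, OfNat.ofNat_ne_zero, not_false_eq_true, zero_pow, mul_zero, add_zero] at h1
    linarith
  · have h1 := key ‖ι f‖⁻¹ (by positivity)
    rw [inv_mul_le_iff₀ h0, ← mul_pow, inv_mul_cancel₀ h0.ne', one_pow] at h1
    calc ‖G.eval z‖ ≤ _ := h1
      _ = _ := by ring

end Form

/-! ### Lagrange interpolation on the fibres and boundedness of point evaluations. -/

theorem Polynomial.norm_mul_eval_le_of_roots {q f : ℂ[X]} {D : ℂ} {b : ℂ → ℂ} {B : ℝ}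
    (hf : f.degree < q.natDegree) (hD : ∀ u ∈ q.roots, D = b u * q.derivative.eval u)
    (hu : ∀ u ∈ q.roots, ‖u‖ ≤ 1) (hb : ∀ u ∈ q.roots, ‖b u‖ ≤ B) (hB : 0 ≤ B) (w : ℂ) :
    ‖D * f.eval w‖ ≤ B * ‖q.leadingCoeff‖ * (‖w‖ + 1) ^ q.natDegree *
      (q.roots.map fun u => ‖f.eval u‖).sum := by
  classical
  have hnn : 0 ≤ (q.roots.map fun u => ‖f.eval u‖).sum := Multiset.sum_nonneg fun x hx => by
    obtain ⟨u, -, rfl⟩ := Multiset.mem_map.1 hx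
    exact norm_nonneg _
  by_cases hD0 : D = 0
  · rw [hD0, zero_mul, norm_zero]
    positivity
  rcases eq_or_ne q 0 with rfl | hq0
  · simp only [natDegree_zero, Nat.cast_zero, Nat.WithBot.lt_zero_iff, degree_eq_bot] at hf
    simp [hf]
  -- At a multiple root q' vanishes, and `hD` would give D = 0.
  have hnodup : q.roots.Nodup := by
    rw [Multiset.nodup_iff_count_le_one]
    intro u
    by_contra! hlt
    rw [count_roots, one_lt_rootMultiplicity_iff_isRoot hq0] at hlt
    refine hD0 ?_
    rw [hD u ((mem_roots hq0).2 hlt.1), hlt.2.eq_zero, mul_zero]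
  set s := q.roots.toFinset with hs
  have hsval : s.val = q.roots := by rw [hs, Multiset.toFinset_val, hnodup.dedup]
  have hcard : s.card = q.natDegree := by
    rw [Finset.card_def, hsval]
    exact (IsAlgClosed.splits q).natDegree_eq_card_roots.symm
  have hmem : ∀ u, u ∈ s ↔ u ∈ q.roots := fun u => Multiset.mem_toFinset
  have hprod : q = C q.leadingCoeff * Lagrange.nodal s id := by
    conv_lhs => rw [(IsAlgClosed.splits q).eq_prod_roots]
    rw [Lagrange.nodal, Finset.prod, hsval]
    rfl
  have hder : ∀ u ∈ s, q.derivative.eval u = q.leadingCoeff * ∏ v ∈ s.erase u, (u - v) := by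
    intro u hu
    have h1 := Lagrange.eval_nodal_derivative_eval_node_eq (v := (id : ℂ → ℂ)) hu
    rw [Lagrange.eval_nodal] at h1
    conv_lhs => rw [hprod]
    rw [derivative_C_mul, eval_mul, eval_C]
    congr 1
  have hint := Lagrange.eq_interpolate (s := s) (v := (id : ℂ → ℂ)) (f := f)
    Function.injective_id.injOn (by rw [hcard]; exact hf)
  -- The denominators of the Lagrange basis multiply to q'(u) up to the leading coefficient; the
  -- factor D = b(u) q'(u) clears them, which keeps the bound uniform as roots approach each other.
  have hterm : ∀ u ∈ s, D * (Lagrange.basis s id u).eval w =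
      b u * (q.leadingCoeff * ∏ v ∈ s.erase u, (w - v)) := by
    intro u hu
    rw [hD u ((hmem u).1 hu), hder u hu, Lagrange.basis, eval_prod]
    rw [mul_assoc, mul_assoc, ← Finset.prod_mul_distrib]
    congr 2
    refine Finset.prod_congr rfl fun v hv => ?_
    have hne : u - v ≠ 0 := sub_ne_zero.2 (Finset.ne_of_mem_erase hv).symm
    simp only [Lagrange.basisDivisor, id, eval_mul, eval_C, eval_sub, eval_X]
    rw [mul_inv_cancel_left₀ hne]
  have heq : D * f.eval w = ∑ u ∈ s, f.eval u * (b u * (q.leadingCoeff *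
      ∏ v ∈ s.erase u, (w - v))) := by
    conv_lhs => rw [hint]
    rw [Lagrange.interpolate_apply, eval_finsetSum, Finset.mul_sum]
    refine Finset.sum_congr rfl fun u hu => ?_
    rw [eval_mul, eval_C, mul_left_comm, hterm u hu]
    rfl
  rw [heq]
  have hsum : (q.roots.map fun u => ‖f.eval u‖).sum = ∑ u ∈ s, ‖f.eval u‖ := by
    rw [Finset.sum, hsval]
  rw [hsum, Finset.mul_sum]
  refine norm_sum_le_of_le _ fun u hus => ?_
  rw [norm_mul, norm_mul, norm_mul, mul_comm, mul_assoc B]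
  refine mul_le_mul_of_nonneg_right ?_ (norm_nonneg _)
  refine mul_le_mul (hb u ((hmem u).1 hus)) ?_ (by positivity) hB
  refine mul_le_mul_of_nonneg_left ?_ (norm_nonneg _)
  rw [norm_prod]
  have h1 : ∏ v ∈ s.erase u, ‖w - v‖ ≤ ∏ v ∈ s.erase u, (‖w‖ + 1) :=
    Finset.prod_le_prod (fun _ _ => norm_nonneg _) fun v hv =>
      (norm_sub_le _ _).trans
        (by gcongr; exact hu v ((hmem v).1 (Finset.mem_of_mem_erase hv)))
  refine h1.trans ?_
  rw [Finset.prod_const]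
  refine pow_le_pow_right₀ (by linarith [norm_nonneg w]) ?_
  rw [← hcard]
  exact Finset.card_le_card (Finset.erase_subset _ _)

section Curve

variable {P : ℂ[X][X]}

theorem Polynomial.derivative_fiber (P : ℂ[X][X]) (z : ℂ) :
    (P.fiber z).derivative = P.derivative.fiber z := by
  rw [fiber, fiber, derivative_map]

variable {K : Type} [NormedAddCommGroup K] [InnerProductSpace ℂ K] {ι : ℂ[X][X] →ₗ[ℂ] K}

/-- For fixed w, interpolation at the roots of P(x,·) bounds D(x)·g(x,w) on |x| = 1 by the values of
f on the curve. This is a polynomial in x, so the discrete Cauchy estimate carries the bound to |z|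
< 1, where D and the leading coefficient can be divided out. -/
theorem exists_norm_evalEval_le_norm
    (hT : ∀ z w : ℂ, ‖z‖ = 1 → P.evalEval z w = 0 → ‖w‖ = 1)
    (hι : ∀ f g, ⟪ι f, ι g⟫_ℂ = (curveForm hT).inner f g)
    (hlc : ∀ z : ℂ, ‖z‖ = 1 → P.leadingCoeff.eval z ≠ 0)
    {D : ℂ[X]} {a b : ℂ[X][X]} (hD : C D = P * a + P.derivative * b)
    {z w : ℂ} (hz : ‖z‖ < 1) (hP : P.evalEval z w = 0) (hDz : D.eval z ≠ 0)
    (hlz : P.leadingCoeff.eval z ≠ 0) :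
    ∃ A : ℝ, ∀ f : ℂ[X][X], f.degree ≤ P.natDegree → ‖f.evalEval z w‖ ≤ A * ‖ι f‖ := by
  have hP0 : P ≠ 0 := by rintro rfl; simp at hlz
  obtain ⟨B, hB⟩ := exists_norm_evalEval_le 1 b
  obtain ⟨L, hL⟩ := exists_norm_evalEval_le 1 (C P.leadingCoeff)
  simp only [evalEval_C] at hL
  have hB0 : 0 ≤ B := (norm_nonneg _).trans (hB 0 0 (by simp) (by simp))
  have hL0 : 0 ≤ L := (norm_nonneg _).trans (hL 0 0 (by simp) (by simp))
  set A₀ : ℝ := B * L * (‖w‖ + 1) ^ P.natDegree * L with hA₀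
  have hA₀0 : 0 ≤ A₀ := by positivity
  refine ⟨(‖D.eval z‖ * ‖P.leadingCoeff.eval z‖)⁻¹ *
    ((1 - ‖z‖)⁻¹ * A₀ * (P.natDegree + 1)), fun f hf => ?_⟩
  -- Interpolation at m nodes requires w-degree < m; this combination removes the coefficient of w^m
  -- and equals the leading coefficient times f on the curve.
  set g : ℂ[X][X] := C P.leadingCoeff * f - C (f.coeff P.natDegree) * P with hg
  have hgdeg : g.degree < P.natDegree := by
    rw [degree_lt_iff_coeff_zero]
    intro k hk
    rw [hg, coeff_sub, coeff_C_mul, coeff_C_mul]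
    rcases hk.eq_or_lt with rfl | hk
    · rw [coeff_natDegree]; ring
    · rw [coeff_eq_zero_of_natDegree_lt hk, coeff_eq_zero_of_degree_lt
        (hf.trans_lt (by exact_mod_cast hk))]
      ring
  have hgev : ∀ x y, P.evalEval x y = 0 →
      g.evalEval x y = P.leadingCoeff.eval x * f.evalEval x y := fun x y hxy => by
    rw [hg, evalEval_sub, evalEval_mul, evalEval_mul, hxy, evalEval_C, mul_zero, sub_zero]
  have hdom := norm_eval_le_of_dominated hT hι (f := f) (G := D * g.eval (C w)) hA₀0
    (fun x hx => ?_) hz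
  · have h1 : (D * g.eval (C w)).eval z =
        D.eval z * (P.leadingCoeff.eval z * f.evalEval z w) := by
      rw [eval_mul]
      exact congrArg _ (hgev z w hP)
    rw [h1, norm_mul, norm_mul, ← mul_assoc] at hdom
    rw [mul_assoc, ← div_eq_inv_mul, le_div_iff₀' (by positivity)]
    exact hdom
  · have hfib : (P.fiber x).natDegree = P.natDegree := natDegree_fiber P x (hlc x hx)
    have hroot : ∀ u ∈ (P.fiber x).roots, P.evalEval x u = 0 :=
      fun u hu => evalEval_eq_zero_of_mem_roots_fiber hu
    have hu1 : ∀ u ∈ (P.fiber x).roots, ‖u‖ ≤ 1 := fun u hu => (hT x u hx (hroot u hu)).le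
    have h1 := norm_mul_eval_le_of_roots (q := P.fiber x) (f := g.fiber x) (D := D.eval x)
      (b := fun u => b.evalEval x u) (B := B) ?_ ?_ hu1
      (fun u hu => hB x u hx.le (hu1 u hu)) hB0 w
    · rw [eval_mul]
      have h2 : eval x (eval (C w) g) = (g.fiber x).eval w := (eval_fiber g x w).symm
      rw [h2]
      refine h1.trans ?_
      have h3 : (P.fiber x).leadingCoeff = P.leadingCoeff.eval x := by
        rw [leadingCoeff, hfib, coeff_fiber, coeff_natDegree]
      have h4 : ((P.fiber x).roots.map fun u => ‖(g.fiber x).eval u‖).sum ≤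
          ((P.fiber x).roots.map fun u => L * ‖f.evalEval x u‖).sum := by
        refine Multiset.sum_map_le_sum_map _ _ fun u hu => ?_
        rw [eval_fiber, hgev x u (hroot u hu), norm_mul]
        exact mul_le_mul_of_nonneg_right (hL x 0 hx.le (by simp)) (norm_nonneg _)
      have h6 : A₀ * ((P.fiber x).roots.map fun u => ‖f.evalEval x u‖).sum =
          B * L * (‖w‖ + 1) ^ P.natDegree *
            ((P.fiber x).roots.map fun u => L * ‖f.evalEval x u‖).sum := by
        rw [hA₀, Multiset.sum_map_mul_left]; ring
      rw [h3, hfib, h6]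
      have h5 : ‖P.leadingCoeff.eval x‖ ≤ L := hL x 0 hx.le (by simp)
      gcongr
      exact Multiset.sum_nonneg fun y hy => by
        obtain ⟨u, -, rfl⟩ := Multiset.mem_map.1 hy
        exact norm_nonneg _
    · rw [hfib]
      exact degree_map_le.trans_lt hgdeg
    · intro u hu
      have h2 := congrArg (evalEval x u) hD
      rw [evalEval_C, evalEval_add, evalEval_mul, evalEval_mul, hroot u hu, zero_mul,
        zero_add] at h2
      rw [h2, derivative_fiber, eval_fiber, mul_comm]

end Curve

/-! ### Reflection in the circle and in the torus. -/

/-- The polynomial `z ^ N * conj (f (1 / conj z))`. -/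
noncomputable def Polynomial.conjReflect (N : ℕ) (f : ℂ[X]) : ℂ[X] :=
  reflect N (f.map (starRingEnd ℂ))

theorem Polynomial.eval_conjReflect {N : ℕ} {f : ℂ[X]} (hf : f.natDegree ≤ N) {z : ℂ}
    (hz : z ≠ 0) : (conjReflect N f).eval z = z ^ N * conj (f.eval (conj z)⁻¹) := by
  let _ : Invertible z⁻¹ := invertibleOfNonzero (inv_ne_zero hz)
  have h1 := eval₂_reflect_mul_pow (RingHom.id ℂ) z⁻¹ N (f.map (starRingEnd ℂ))
    (natDegree_map_le.trans hf)
  rw [invOf_eq_inv, inv_inv, ← eval, ← eval, inv_pow,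
    mul_inv_eq_iff_eq_mul₀ (pow_ne_zero _ hz)] at h1
  have h2 : (f.map (starRingEnd ℂ)).eval z⁻¹ = conj (f.eval (conj z)⁻¹) := by
    rw [eval_map, ← eval₂_hom, map_inv₀, Complex.conj_conj]
  rw [conjReflect, h1, h2, mul_comm]

theorem Polynomial.natDegree_conjReflect_le {N : ℕ} {f : ℂ[X]} (hf : f.natDegree ≤ N) :
    (conjReflect N f).natDegree ≤ N :=
  natDegree_reflect_le.trans (max_le le_rfl (natDegree_map_le.trans hf))

theorem Polynomial.conjReflect_ne_zero {N : ℕ} {f : ℂ[X]} (hf : f ≠ 0) :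
    conjReflect N f ≠ 0 := by
  rw [conjReflect, Ne, reflect_eq_zero_iff]
  exact (Polynomial.map_ne_zero hf)

theorem Polynomial.conjReflect_mul {M N : ℕ} {f g : ℂ[X]} (hf : f.natDegree ≤ M)
    (hg : g.natDegree ≤ N) :
    conjReflect (M + N) (f * g) = conjReflect M f * conjReflect N g := by
  rw [conjReflect, Polynomial.map_mul, reflect_mul _ _ (natDegree_map_le.trans hf)
    (natDegree_map_le.trans hg)]
  rfl

theorem Complex.conj_inv_eq_self_of_norm_eq_one {z : ℂ} (hz : ‖z‖ = 1) : (conj z)⁻¹ = z := by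
  rw [← Complex.inv_eq_conj hz, inv_inv]

/-- The bivariate reflection `z ^ n * w ^ m * conj (P (1 / conj z, 1 / conj w))`. -/
noncomputable def Polynomial.biReflect (n : ℕ) (P : ℂ[X][X]) : ℂ[X][X] :=
  ∑ j ∈ Finset.range (P.natDegree + 1), C (conjReflect n (P.coeff (P.natDegree - j))) * X ^ j

theorem Polynomial.coeff_biReflect (n : ℕ) (P : ℂ[X][X]) {j : ℕ} (hj : j ≤ P.natDegree) :
    (biReflect n P).coeff j = conjReflect n (P.coeff (P.natDegree - j)) := by
  rw [biReflect, finsetSum_coeff]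
  simp_rw [coeff_C_mul_X_pow]
  rw [Finset.sum_ite_eq, if_pos (by simpa [Nat.lt_succ_iff] using hj)]

theorem Polynomial.natDegree_biReflect_le (n : ℕ) (P : ℂ[X][X]) :
    (biReflect n P).natDegree ≤ P.natDegree :=
  natDegree_sum_le_of_forall_le _ _ fun j hj =>
    (natDegree_C_mul_X_pow_le _ _).trans (by simpa [Nat.lt_succ_iff] using hj)

theorem Polynomial.evalEval_biReflect {n : ℕ} {P : ℂ[X][X]} (hn : ∀ j, (P.coeff j).natDegree ≤ n)
    {z w : ℂ} (hz : ‖z‖ = 1) (hw : ‖w‖ = 1) :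
    (biReflect n P).evalEval z w = z ^ n * w ^ P.natDegree * conj (P.evalEval z w) := by
  have hz0 : z ≠ 0 := by rintro rfl; simp at hz
  have hw0 : w ≠ 0 := by rintro rfl; simp at hw
  have h1 : P.evalEval z w = ∑ j ∈ Finset.range (P.natDegree + 1), (P.coeff j).eval z * w ^ j := by
    conv_lhs => rw [evalEval, eval_eq_sum_range (p := P), eval_finsetSum]
    refine Finset.sum_congr rfl fun j _ => ?_
    rw [eval_mul, eval_pow, eval_C]
  rw [biReflect, evalEval_finsetSum, h1, map_sum, Finset.mul_sum,
    ← Finset.sum_flip (n := P.natDegree)]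
  refine Finset.sum_congr rfl fun j hj => ?_
  have hj' : j ≤ P.natDegree := by simpa [Nat.lt_succ_iff] using hj
  rw [evalEval_mul, evalEval_C, evalEval_pow, evalEval_X, Nat.sub_sub_self hj',
    eval_conjReflect (hn j) hz0, Complex.conj_inv_eq_self_of_norm_eq_one hz, map_mul, map_pow,
    ← Complex.inv_eq_conj hw, pow_sub₀ w hw0 hj', inv_pow]
  ring

section Reflection

variable {P : ℂ[X][X]} {n : ℕ}

theorem coeff_zero_eval_ne_zero (hT : ∀ z w : ℂ, ‖z‖ = 1 → P.evalEval z w = 0 → ‖w‖ = 1)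
    {z : ℂ} (hz : ‖z‖ = 1) : (P.coeff 0).eval z ≠ 0 := fun h => by
  have := hT z 0 hz (by rw [evalEval, C_0, ← coeff_zero_eq_eval_zero, h])
  simp at this

/-- On the torus the reflection of P vanishes wherever P does, so P divides it. The degrees in both
variables leave only a constant quotient, and comparing coefficients of w^m gives the identity. -/
theorem exists_conjReflect_coeff_zero_eq (hP : Irreducible P) (hm : P.natDegree ≠ 0)
    (hT : ∀ z w : ℂ, ‖z‖ = 1 → P.evalEval z w = 0 → ‖w‖ = 1)
    (hn : ∀ j, (P.coeff j).natDegree ≤ n) (hn' : ∃ j, P.coeff j ≠ 0 ∧ (P.coeff j).natDegree = n) :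
    ∃ s : ℂ, s ≠ 0 ∧ conjReflect n (P.coeff 0) = C s * P.leadingCoeff := by
  have hP0 : P.leadingCoeff ≠ 0 := leadingCoeff_ne_zero.2 hP.ne_zero
  have hc0 : P.coeff 0 ≠ 0 := fun h => by
    refine coeff_zero_eval_ne_zero hT (z := 1) (by simp) ?_
    rw [h, eval_zero]
  -- The zeros of the leading coefficient are removed so that the fibre has full degree and hence a
  -- root; that there are none on the circle follows only later, from the conclusion of this lemma.
  have hinf : ({z : ℂ | ‖z‖ = 1} \ {z | P.leadingCoeff.IsRoot z}).Infinite :=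
    Complex.infinite_sphere.sdiff (finite_setOfPred_isRoot hP0)
  have hdvd : P ∣ biReflect n P := by
    refine dvd_of_infinite_common_zeros hP hm hinf fun z hz => ?_
    have hz1 : ‖z‖ = 1 := hz.1
    obtain ⟨w, hw⟩ := IsAlgClosed.exists_root (P.fiber z) (by
      refine fun h => hm ?_
      rw [← natDegree_fiber P z hz.2]
      exact natDegree_eq_of_degree_eq_some h)
    have hw0 : P.evalEval z w = 0 := by rw [← eval_fiber]; exact hw
    exact ⟨w, hw0, by rw [evalEval_biReflect hn hz1 (hT z w hz1 hw0), hw0, map_zero, mul_zero]⟩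
  obtain ⟨Q, hQ⟩ := hdvd
  have htop : (biReflect n P).coeff P.natDegree = conjReflect n (P.coeff 0) := by
    rw [coeff_biReflect n P le_rfl, Nat.sub_self]
  have hR0 : biReflect n P ≠ 0 := fun h => by
    rw [h, coeff_zero] at htop
    exact conjReflect_ne_zero hc0 htop.symm
  have hQ0 : Q ≠ 0 := by rintro rfl; exact hR0 (by rw [hQ, mul_zero])
  have hQd : Q.natDegree = 0 := by
    have h1 := natDegree_biReflect_le n P
    rw [hQ, natDegree_mul hP.ne_zero hQ0] at h1
    omega
  obtain ⟨q, rfl⟩ : ∃ q, Q = C q := ⟨_, eq_C_of_natDegree_eq_zero hQd⟩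
  have hq0 : q ≠ 0 := by rintro rfl; exact hQ0 C_0
  have hcoef : ∀ j ≤ P.natDegree, conjReflect n (P.coeff (P.natDegree - j)) = P.coeff j * q :=
    fun j hj => by rw [← coeff_biReflect n P hj, hQ, coeff_mul_C]
  obtain ⟨j, hj0, hjn⟩ := hn'
  have hqd : q.natDegree = 0 := by
    have h1 := natDegree_conjReflect_le (hn (P.natDegree - j))
    rw [hcoef j (le_natDegree_of_ne_zero hj0), natDegree_mul hj0 hq0] at h1
    omega
  obtain ⟨s, rfl⟩ : ∃ s, q = C s := ⟨_, eq_C_of_natDegree_eq_zero hqd⟩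
  refine ⟨s, by rintro rfl; exact hq0 C_0, ?_⟩
  have h1 := hcoef P.natDegree le_rfl
  rw [Nat.sub_self] at h1
  rw [h1, mul_comm]
  rfl

theorem leadingCoeff_eval_ne_zero (hT : ∀ z w : ℂ, ‖z‖ = 1 → P.evalEval z w = 0 → ‖w‖ = 1)
    (hn : ∀ j, (P.coeff j).natDegree ≤ n) {s : ℂ}
    (hs : conjReflect n (P.coeff 0) = C s * P.leadingCoeff) {z : ℂ} (hz : ‖z‖ = 1) :
    P.leadingCoeff.eval z ≠ 0 := fun h => by
  have hz0 : z ≠ 0 := by rintro rfl; simp at hz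
  have h1 := congrArg (eval z) hs
  rw [eval_conjReflect (hn 0) hz0, Complex.conj_inv_eq_self_of_norm_eq_one hz, eval_mul, h,
    mul_zero, mul_eq_zero, or_iff_right (pow_ne_zero _ hz0), map_eq_zero] at h1
  exact coeff_zero_eval_ne_zero hT hz h1

open Classical in
/-- A factorisation into zeros in the unit disk and zeros in the exterior. -/
theorem Polynomial.exists_eq_mul_of_roots_disk {f : ℂ[X]} (hf : f ≠ 0)
    (hT : ∀ z : ℂ, ‖z‖ = 1 → f.eval z ≠ 0) :
    ∃ d u : ℂ[X], f = d * u ∧ d.Monic ∧ (∀ z, d.IsRoot z → ‖z‖ < 1) ∧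
      d.natDegree = Multiset.card (f.roots.filter fun z => ‖z‖ < 1) ∧ u ≠ 0 ∧
      ∀ z, u.IsRoot z → 1 < ‖z‖ := by
  set d : ℂ[X] := ((f.roots.filter fun z => ‖z‖ < 1).map fun a => X - C a).prod with hd
  set v : ℂ[X] := ((f.roots.filter fun z => ¬ ‖z‖ < 1).map fun a => X - C a).prod with hv
  have hdm : d.Monic := monic_multiset_prod_of_monic _ _ fun a _ => monic_X_sub_C a
  have hvm : v.Monic := monic_multiset_prod_of_monic _ _ fun a _ => monic_X_sub_C a
  have hlc : C f.leadingCoeff ≠ 0 := C_ne_zero.2 (leadingCoeff_ne_zero.2 hf)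
  have hroots : ∀ s : Multiset ℂ, ∀ z, ((s.map fun a => X - C a).prod : ℂ[X]).IsRoot z → z ∈ s := by
    intro s z hz
    rw [← mem_roots (monic_multiset_prod_of_monic _ _ fun a _ => monic_X_sub_C a).ne_zero,
      roots_multiset_prod_X_sub_C] at hz
    exact hz
  refine ⟨d, C f.leadingCoeff * v, ?_, hdm, ?_, ?_, mul_ne_zero hlc hvm.ne_zero, ?_⟩
  · rw [mul_left_comm, hd, hv, ← Multiset.prod_add, ← Multiset.map_add, Multiset.filter_add_not]
    exact (IsAlgClosed.splits f).eq_prod_roots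
  · intro z hz
    exact (Multiset.mem_filter.1 (hroots _ z hz)).2
  · rw [hd, natDegree_multiset_prod_X_sub_C_eq_card]
  · intro z hz
    rw [IsRoot, eval_mul, eval_C, mul_eq_zero,
      or_iff_right (leadingCoeff_ne_zero.2 hf)] at hz
    have h1 := Multiset.mem_filter.1 (hroots _ z hz)
    refine lt_of_le_of_ne (not_lt.1 h1.2) fun h => hT z h.symm ?_
    exact isRoot_of_mem_roots h1.1

-- Write P(z,0) = d·u with the zeros of d in 𝔻 and those of u in 𝔼. Reflection exchanges 𝔻 and 𝔼, so
-- the leading coefficient splits as d' = reflection of u, of degree at most n − deg d, times u' = a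
-- multiple of the reflection of d, with zeros in 𝔼.
open Classical in
theorem exists_factorizations (hP : Irreducible P) (hm : P.natDegree ≠ 0)
    (hT : ∀ z w : ℂ, ‖z‖ = 1 → P.evalEval z w = 0 → ‖w‖ = 1)
    (hn : ∀ j, (P.coeff j).natDegree ≤ n) (hn' : ∃ j, P.coeff j ≠ 0 ∧ (P.coeff j).natDegree = n) :
    ∃ d u d' u' : ℂ[X], P.coeff 0 = d * u ∧ P.leadingCoeff = d' * u' ∧ d ≠ 0 ∧ d' ≠ 0 ∧
      u ≠ 0 ∧ u' ≠ 0 ∧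
      d.natDegree = Multiset.card ((P.coeff 0).roots.filter fun z => ‖z‖ < 1) ∧
      d.natDegree + d'.natDegree ≤ n ∧ (∀ z, u.IsRoot z → 1 < ‖z‖) ∧
      (∀ z, u'.IsRoot z → 1 < ‖z‖) ∧ ∀ z : ℂ, ‖z‖ = 1 → P.leadingCoeff.eval z ≠ 0 := by
  obtain ⟨s, hs0, hs⟩ := exists_conjReflect_coeff_zero_eq hP hm hT hn hn'
  have hc0 : P.coeff 0 ≠ 0 := fun h => by
    refine coeff_zero_eval_ne_zero hT (z := 1) (by simp) ?_
    rw [h, eval_zero]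
  obtain ⟨d, u, hdu, hd, hdroot, hdcard, hu0, huroot⟩ :=
    exists_eq_mul_of_roots_disk hc0 fun z hz => coeff_zero_eval_ne_zero hT hz
  have hdeg : d.natDegree + u.natDegree ≤ n := by
    rw [← natDegree_mul hd.ne_zero hu0, ← hdu]
    exact hn 0
  have hun : u.natDegree ≤ n - d.natDegree := by omega
  have hprod : conjReflect n (P.coeff 0) =
      conjReflect d.natDegree d * conjReflect (n - d.natDegree) u := by
    rw [← conjReflect_mul le_rfl hun, ← hdu]
    congr 1
    omega
  refine ⟨d, u, conjReflect (n - d.natDegree) u, C s⁻¹ * conjReflect d.natDegree d, hdu, ?_,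
    hd.ne_zero, conjReflect_ne_zero hu0, hu0,
    mul_ne_zero (C_ne_zero.2 (inv_ne_zero hs0)) (conjReflect_ne_zero hd.ne_zero), hdcard, ?_,
    huroot, ?_, fun z hz => leadingCoeff_eval_ne_zero hT hn hs hz⟩
  · rw [mul_left_comm, mul_comm (conjReflect _ u), ← hprod, hs, ← mul_assoc, ← C_mul,
      inv_mul_cancel₀ hs0, C_1, one_mul]
  · have := natDegree_conjReflect_le hun
    omega
  · intro z hz
    rw [IsRoot, eval_mul, eval_C, mul_eq_zero, or_iff_right (inv_ne_zero hs0)] at hz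
    -- The constant term of the reflection of d at its exact degree is the conjugate of its leading
    -- coefficient, which is 1.
    have hz0 : z ≠ 0 := by
      rintro rfl
      rw [← coeff_zero_eq_eval_zero, conjReflect, coeff_reflect, revAt_zero, coeff_map,
        coeff_natDegree, hd.leadingCoeff, map_one] at hz
      exact one_ne_zero hz
    rw [eval_conjReflect le_rfl hz0, mul_eq_zero, or_iff_right (pow_ne_zero _ hz0),
      map_eq_zero] at hz
    have h1 := hdroot _ hz
    rw [norm_inv, RCLike.norm_conj] at h1
    exact (inv_lt_one₀ (norm_pos_iff.2 hz0)).1 h1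

end Reflection

theorem map_det_pencil {ι R S : Type*} [Fintype ι] [DecidableEq ι] [CommRing R] [Algebra ℂ R]
    [CommRing S] [Algebra ℂ S] (f : R →+* S) (hf : ∀ c, f (algebraMap ℂ R c) = algebraMap ℂ S c)
    (U : Matrix ι ι ℂ) (κ : ι → Fin 3) (z w : R) :
    f (pencil U κ z w).det = (pencil U κ (f z) (f w)).det := by
  rw [RingHom.map_det]
  congr 1
  have h1 : ∀ i, f (diagDelta κ z w i) = diagDelta κ (f z) (f w) i := fun i => by
    unfold diagDelta
    generalize κ i = k
    fin_cases k <;> simp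
  have h2 : ∀ i, f (diagGamma κ z i) = diagGamma κ (f z) i := fun i => by
    unfold diagGamma
    generalize κ i = k
    fin_cases k <;> simp
  ext i j
  rw [RingHom.mapMatrix_apply, Matrix.map_apply, pencil, pencil, Matrix.sub_apply,
    Matrix.sub_apply, Matrix.mul_diagonal, Matrix.mul_diagonal, map_sub, map_mul, h1,
    Matrix.map_apply, Matrix.map_apply, hf, Matrix.diagonal_apply, Matrix.diagonal_apply]
  split_ifs <;> simp [h2]

/-- Polynomials of degree less than `k` in the outer variable. -/
noncomputable def outerDegreeLT (k : ℕ) : Submodule ℂ ℂ[X][X] :=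
  (degreeLT ℂ[X] k).restrictScalars ℂ

theorem mem_outerDegreeLT {k : ℕ} {f : ℂ[X][X]} : f ∈ outerDegreeLT k ↔ f.degree < k := mem_degreeLT

theorem finrank_quotient_span_singleton {d : ℂ[X]} (hd : d ≠ 0) :
    FiniteDimensional ℂ (ℂ[X] ⧸ Ideal.span {d}) ∧
      Module.finrank ℂ (ℂ[X] ⧸ Ideal.span {d}) = d.natDegree :=
  ⟨(AdjoinRoot.powerBasis hd).finite, finrank_quotient_span_eq_natDegree⟩

theorem Polynomial.smul_eq_C_C_mul (c : ℂ) (f : ℂ[X][X]) : c • f = C (C c) * f := by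
  ext
  simp

/-! ### The polynomial model and the dimensions of its three orthogonal differences. -/

section Model

variable {K : Type} [NormedAddCommGroup K] [InnerProductSpace ℂ K] {ι : ℂ[X][X] →ₗ[ℂ] K}
  {Z W : K →ₗᵢ[ℂ] K}

/-- The linear factors z − a of u have |a| > 1 and are removed one at a time by
`mem_of_isometry_sub_smul_mem`. -/
theorem mem_of_C_mul_mem (hZ : ∀ f, Z (ι f) = ι (C X * f)) (N : Submodule ℂ K)
    [N.HasOrthogonalProjection] (hN : N.map Z.toLinearMap ≤ N) {u : ℂ[X]} (hu0 : u ≠ 0)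
    (hu : ∀ z, u.IsRoot z → 1 < ‖z‖) {f : ℂ[X][X]} (hf : ι (C u * f) ∈ N) : ι f ∈ N := by
  have key : ∀ s : Multiset ℂ, (∀ a ∈ s, 1 < ‖a‖) → ∀ g : ℂ[X][X],
      ι (C (s.map fun a => X - C a).prod * g) ∈ N → ι g ∈ N := by
    intro s
    induction s using Multiset.induction with
    | empty => intro _ g hg; simpa using hg
    | cons a s ih =>
      intro hs g hg
      refine ih (fun b hb => hs b (Multiset.mem_cons_of_mem hb)) g ?_
      refine mem_of_isometry_sub_smul_mem Z N hN (hs a (Multiset.mem_cons_self a s)) ?_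
      rw [hZ, ← map_smul, ← map_sub]
      convert hg using 2
      rw [Multiset.map_cons, Multiset.prod_cons, C_mul, C_sub, smul_eq_C_C_mul]
      ring
  refine key u.roots (fun a ha => hu a (isRoot_of_mem_roots ha)) f ?_
  have hlc : u.leadingCoeff ≠ 0 := leadingCoeff_ne_zero.2 hu0
  rw [(IsAlgClosed.splits u).eq_prod_roots, C_mul, mul_assoc, ← smul_eq_C_C_mul, map_smul] at hf
  exact (Submodule.smul_mem_iff N hlc).1 hf

/-- The closure of the image of the polynomials of degree less than `k` in the outer variable. -/
noncomputable def closedImage (ι : ℂ[X][X] →ₗ[ℂ] K) (k : ℕ) : Submodule ℂ K :=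
  ((outerDegreeLT k).map ι).topologicalClosure

theorem mem_closedImage {k : ℕ} {f : ℂ[X][X]} (hf : f.degree < k) : ι f ∈ closedImage ι k :=
  Submodule.le_topologicalClosure _ ⟨f, mem_outerDegreeLT.2 hf, rfl⟩

theorem closedImage_mono {k l : ℕ} (h : k ≤ l) : closedImage ι k ≤ closedImage ι l :=
  Submodule.topologicalClosure_mono (Submodule.map_mono fun f hf =>
    mem_outerDegreeLT.2 ((mem_outerDegreeLT.1 hf).trans_le (by exact_mod_cast h)))

theorem map_Z_closedImage_le (hZ : ∀ f, Z (ι f) = ι (C X * f)) (k : ℕ) :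
    (closedImage ι k).map Z.toLinearMap ≤ closedImage ι k := by
  refine Submodule.map_topologicalClosure_le_of_map_le Z ?_
  rintro _ ⟨_, ⟨f, hf, rfl⟩, rfl⟩
  refine ⟨C X * f, mem_outerDegreeLT.2 ?_, (hZ f).symm⟩
  rw [degree_C_mul X_ne_zero]
  exact mem_outerDegreeLT.1 hf

theorem map_W_closedImage_le (hW : ∀ f, W (ι f) = ι (X * f)) (k : ℕ) :
    (closedImage ι k).map W.toLinearMap ≤ closedImage ι (k + 1) := by
  refine Submodule.map_topologicalClosure_le_of_map_le W ?_
  rintro _ ⟨_, ⟨f, hf, rfl⟩, rfl⟩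
  refine ⟨X * f, mem_outerDegreeLT.2 ?_, (hW f).symm⟩
  rw [mul_comm, degree_mul_X]
  have h1 := mem_outerDegreeLT.1 hf
  rcases eq_or_ne f 0 with rfl | h0
  · simp
  · rw [degree_eq_natDegree h0] at h1 ⊢
    norm_cast at h1 ⊢
    omega

theorem degree_divX_lt {k : ℕ} {f : ℂ[X][X]} (hf : f.degree < (k + 1 : ℕ)) :
    f.divX.degree < k := by
  rw [degree_lt_iff_coeff_zero] at hf ⊢
  intro j hj
  rw [coeff_divX]
  exact hf _ (by omega)

theorem isometryModel_closedImage (hι : DenseRange ι) (hZ : ∀ f, Z (ι f) = ι (C X * f))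
    (hW : ∀ f, W (ι f) = ι (X * f)) {m : ℕ} (hm : 0 < m) :
    IsometryModel Z W (closedImage ι m) (closedImage ι (m + 1)) where
  comm x := by
    refine hι.induction_on (p := fun x => Z (W x) = W (Z x)) x
      (isClosed_eq (Z.continuous.comp W.continuous) (W.continuous.comp Z.continuous)) fun f => ?_
    rw [hW, hZ, hZ, hW, mul_left_comm]
  closed := Submodule.isClosed_topologicalClosure _
  closed' := Submodule.isClosed_topologicalClosure _
  le := closedImage_mono (Nat.le_succ m)
  map_W_le := map_W_closedImage_le hW m
  map_Z_le := map_Z_closedImage_le hZ m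
  le_closure := by
    refine Submodule.topologicalClosure_mono ?_
    rintro _ ⟨f, hf, rfl⟩
    rw [← X_mul_divX_add f, map_add, add_comm]
    refine Submodule.add_mem_sup (mem_closedImage ?_)
      ⟨ι f.divX, mem_closedImage (degree_divX_lt (mem_outerDegreeLT.1 hf)), hW _⟩
    exact degree_C_le.trans_lt (by exact_mod_cast hm)

variable [CompleteSpace K]

/-- If the m coefficients of f all vanish at z = 0, then z divides f and ι f lies in ZH: there are m
linear conditions. -/
theorem finrank_orthogonal_map_Z_le (hZ : ∀ f, Z (ι f) = ι (C X * f)) (m : ℕ) :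
    FiniteDimensional ℂ ↥(((closedImage ι m).map Z.toLinearMap)ᗮ ⊓ closedImage ι m) ∧
      Module.finrank ℂ ↥(((closedImage ι m).map Z.toLinearMap)ᗮ ⊓ closedImage ι m) ≤ m := by
  let φ : ℂ[X][X] →ₗ[ℂ] (Fin m → ℂ) :=
    { toFun := fun f j => (f.coeff j).eval 0
      map_add' := fun f g => by ext j; simp
      map_smul' := fun c f => by ext j; simp }
  have : CompleteSpace (closedImage ι m) :=
    (Submodule.isClosed_topologicalClosure _).completeSpace_coe
  have : CompleteSpace ((closedImage ι m).map Z.toLinearMap) := Z.completeSpace_map _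
  have h := finiteDimensional_orthogonal_inf_of_map ι (outerDegreeLT m) φ
    ((closedImage ι m).map Z.toLinearMap) ?_
  · rwa [Module.finrank_fin_fun] at h
  · intro f hf h0
    have hf' := mem_outerDegreeLT.1 hf
    have hdvd : (C X : ℂ[X][X]) ∣ f := by
      rw [C_dvd_iff_dvd_coeff]
      intro j
      rw [X_dvd_iff, coeff_zero_eq_eval_zero]
      rcases lt_or_ge j m with hj | hj
      · exact congrFun h0 ⟨j, hj⟩
      · rw [degree_lt_iff_coeff_zero] at hf'
        rw [hf' j hj, eval_zero]
    obtain ⟨g, rfl⟩ := hdvd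
    rw [degree_C_mul X_ne_zero] at hf'
    exact ⟨ι g, mem_closedImage hf', hZ g⟩

/-- If d divides the constant coefficient, say f₀ = d g, then u f − g P is divisible by w. As P is
null, u f lies in WH, and u can be cancelled because its zeros are in 𝔼. The condition f₀ ≡ 0 mod d
has codimension deg d. -/
theorem finrank_orthogonal_map_W_le (hZ : ∀ f, Z (ι f) = ι (C X * f))
    (hW : ∀ f, W (ι f) = ι (X * f)) (hcomm : ∀ x, Z (W x) = W (Z x)) {P : ℂ[X][X]}
    (hP : ∀ f, ι (P * f) = 0) {d u : ℂ[X]} (hdu : P.coeff 0 = d * u)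
    (hd : d ≠ 0) (hu0 : u ≠ 0) (hu : ∀ z, u.IsRoot z → 1 < ‖z‖) :
    FiniteDimensional ℂ ↥(((closedImage ι P.natDegree).map W.toLinearMap)ᗮ ⊓
        closedImage ι (P.natDegree + 1)) ∧
      Module.finrank ℂ ↥(((closedImage ι P.natDegree).map W.toLinearMap)ᗮ ⊓
        closedImage ι (P.natDegree + 1)) ≤ d.natDegree := by
  set m := P.natDegree with hmdef
  let φ : ℂ[X][X] →ₗ[ℂ] (ℂ[X] ⧸ Ideal.span {d}) :=
    (Ideal.Quotient.mkₐ ℂ (Ideal.span {d})).toLinearMap ∘ₗ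
      (lcoeff ℂ[X] 0).restrictScalars ℂ
  have : CompleteSpace (closedImage ι m) :=
    (Submodule.isClosed_topologicalClosure _).completeSpace_coe
  have : CompleteSpace ((closedImage ι m).map W.toLinearMap) := W.completeSpace_map _
  obtain ⟨_, hfin⟩ := finrank_quotient_span_singleton hd
  have h := finiteDimensional_orthogonal_inf_of_map ι (outerDegreeLT (m + 1)) φ
    ((closedImage ι m).map W.toLinearMap) ?_
  · rwa [hfin] at h
  · intro f hf h0
    have hf' := mem_outerDegreeLT.1 hf
    obtain ⟨g, hg⟩ : d ∣ f.coeff 0 := Ideal.Quotient.eq_zero_iff_dvd _ _ |>.1 h0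
    have hN : ((closedImage ι m).map W.toLinearMap).map Z.toLinearMap ≤
        (closedImage ι m).map W.toLinearMap := by
      rintro _ ⟨_, ⟨x, hx, rfl⟩, rfl⟩
      exact ⟨Z x, map_Z_closedImage_le hZ m ⟨x, hx, rfl⟩, (hcomm x).symm⟩
    refine mem_of_C_mul_mem hZ _ hN hu0 hu ?_
    set q := C u * f - C g * P with hq
    have hq0 : q.coeff 0 = 0 := by
      rw [hq, coeff_sub, coeff_C_mul, coeff_C_mul, hg, hdu]; ring
    have hqX : X * q.divX = q := by
      conv_rhs => rw [← X_mul_divX_add q, hq0, C_0, add_zero]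
    have hqd : q.degree < (m + 1 : ℕ) := by
      refine (degree_sub_le _ _).trans_lt (max_lt ?_ ?_)
      · rw [degree_C_mul hu0]; exact hf'
      · refine lt_of_le_of_lt (degree_mul_le _ _) ?_
        refine lt_of_le_of_lt (add_le_add degree_C_le degree_le_natDegree) ?_
        rw [zero_add]
        exact_mod_cast Nat.lt_succ_self _
    have hfq : C u * f = q + P * C g := by rw [hq]; ring
    rw [hfq, map_add, hP, add_zero, ← hqX, ← hW]
    exact ⟨_, mem_closedImage (degree_divX_lt hqd), rfl⟩

/-- The same argument at the other end: subtracting a multiple of P from u f cancels the coefficient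
of w^m instead of the constant one. -/
theorem finrank_orthogonal_closedImage_le (hZ : ∀ f, Z (ι f) = ι (C X * f)) {P : ℂ[X][X]}
    (hP : ∀ f, ι (P * f) = 0) {d u : ℂ[X]} (hdu : P.leadingCoeff = d * u)
    (hd : d ≠ 0) (hu0 : u ≠ 0) (hu : ∀ z, u.IsRoot z → 1 < ‖z‖) :
    FiniteDimensional ℂ ↥((closedImage ι P.natDegree)ᗮ ⊓ closedImage ι (P.natDegree + 1)) ∧
      Module.finrank ℂ ↥((closedImage ι P.natDegree)ᗮ ⊓ closedImage ι (P.natDegree + 1)) ≤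
        d.natDegree := by
  set m := P.natDegree with hmdef
  let φ : ℂ[X][X] →ₗ[ℂ] (ℂ[X] ⧸ Ideal.span {d}) :=
    (Ideal.Quotient.mkₐ ℂ (Ideal.span {d})).toLinearMap ∘ₗ
      (lcoeff ℂ[X] m).restrictScalars ℂ
  have : CompleteSpace (closedImage ι m) :=
    (Submodule.isClosed_topologicalClosure _).completeSpace_coe
  obtain ⟨_, hfin⟩ := finrank_quotient_span_singleton hd
  have h := finiteDimensional_orthogonal_inf_of_map ι (outerDegreeLT (m + 1)) φ
    (closedImage ι m) ?_
  · rwa [hfin] at h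
  · intro f hf h0
    have hf' := mem_outerDegreeLT.1 hf
    rw [degree_lt_iff_coeff_zero] at hf'
    obtain ⟨g, hg⟩ : d ∣ f.coeff m := Ideal.Quotient.eq_zero_iff_dvd _ _ |>.1 h0
    refine mem_of_C_mul_mem hZ _ (map_Z_closedImage_le hZ m) hu0 hu ?_
    set q := C u * f - C g * P with hq
    have hqd : q.degree < m := by
      rw [degree_lt_iff_coeff_zero]
      intro j hj
      rw [hq, coeff_sub, coeff_C_mul, coeff_C_mul]
      rcases hj.eq_or_lt with rfl | hj
      · rw [hg, hmdef, coeff_natDegree, hdu]; ring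
      · rw [hf' j hj, coeff_eq_zero_of_natDegree_lt hj]; ring
    have hfq : C u * f = q + P * C g := by rw [hq]; ring
    rw [hfq, map_add, hP, add_zero]
    exact mem_closedImage hqd

end Model

/-! ### Irreducible polynomials divide a nonzero determinant of controlled size. -/

open Classical in
theorem exists_unitary_dvd_det_pencil {P : ℂ[X][X]} {n : ℕ} (hP : Irreducible P)
    (hm : P.natDegree ≠ 0) (hT : ∀ z w : ℂ, ‖z‖ = 1 → P.evalEval z w = 0 → ‖w‖ = 1)
    (hn : ∀ j, (P.coeff j).natDegree ≤ n)
    (hn' : ∃ j, P.coeff j ≠ 0 ∧ (P.coeff j).natDegree = n) :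
    ∃ e a b : ℕ, e ≤ P.natDegree ∧
      b ≤ Multiset.card ((P.coeff 0).roots.filter fun z => ‖z‖ < 1) ∧
      a + Multiset.card ((P.coeff 0).roots.filter fun z => ‖z‖ < 1) ≤ n ∧
      ∃ V ∈ Matrix.unitaryGroup (Fin e ⊕ (Fin a ⊕ Fin b)) ℂ,
        (pencil V (blockLabel (Fin e) (Fin a) (Fin b)) (C X : ℂ[X][X]) X).det ≠ 0 ∧
        P ∣ (pencil V (blockLabel (Fin e) (Fin a) (Fin b)) (C X : ℂ[X][X]) X).det := by
  obtain ⟨d, u, d', u', hdu, hdu', hd, hd', hu0, hu0', hdcard, hdn, hu, hu', hlc⟩ :=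
    exists_factorizations hP hm hT hn hn'
  obtain ⟨K, _, _, _, ι, hdense, hι⟩ := (curveForm hT).exists_hilbert
  have hnorm : ∀ f g : ℂ[X][X], (∀ z w : ℂ, ‖z‖ = 1 → P.evalEval z w = 0 →
      ‖f.evalEval z w‖ = ‖g.evalEval z w‖) → ‖ι f‖ = ‖ι g‖ := by
    intro f g h
    rw [@norm_eq_sqrt_re_inner ℂ, @norm_eq_sqrt_re_inner ℂ _ _ _ _ (ι g), hι, hι]
    rw [curveForm_inner_congr hT fun z w hz hw => ?_]
    rw [Complex.conj_mul', Complex.conj_mul', h z w hz hw]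
  obtain ⟨Z, hZ⟩ := exists_linearIsometry_extending hdense (LinearMap.mulLeft ℂ (C X))
    fun f => hnorm _ _ fun z w hz _ => by simp [evalEval_mul, evalEval_C, hz]
  obtain ⟨W, hW⟩ := exists_linearIsometry_extending hdense (LinearMap.mulLeft ℂ X)
    fun f => hnorm _ _ fun z w hz hw => by simp [evalEval_mul, evalEval_X, hT z w hz hw]
  simp only [LinearMap.mulLeft_apply] at hZ hW
  have hP0 : ∀ f, ι (P * f) = 0 := fun f => by
    have := hnorm (P * f) 0 fun z w _ hw => by rw [evalEval_mul, hw, zero_mul, evalEval_zero]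
    rwa [map_zero, norm_zero, norm_eq_zero] at this
  have hmpos : 0 < P.natDegree := Nat.pos_of_ne_zero hm
  have hM := isometryModel_closedImage hdense hZ hW hmpos
  obtain ⟨_, he⟩ := finrank_orthogonal_map_Z_le (ι := ι) hZ P.natDegree
  obtain ⟨_, ha⟩ := finrank_orthogonal_closedImage_le hZ hP0 hdu' hd' hu0' hu'
  obtain ⟨_, hb⟩ := finrank_orthogonal_map_W_le hZ hW hM.comm hP0 hdu hd hu0 hu
  obtain ⟨ε, hε⟩ := exists_isOrthoDiffBasis ((closedImage ι P.natDegree).map Z.toLinearMap)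
    (closedImage ι P.natDegree)
  obtain ⟨φ, hφ⟩ := exists_isOrthoDiffBasis (closedImage ι P.natDegree)
    (closedImage ι (P.natDegree + 1))
  obtain ⟨g, hg⟩ := exists_isOrthoDiffBasis ((closedImage ι P.natDegree).map W.toLinearMap)
    (closedImage ι (P.natDegree + 1))
  obtain ⟨V, hV, hVeq⟩ := hM.exists_unitary hε hφ hg
  have hmap : ∀ x y : ℂ, evalEval x y (pencil V (blockLabel _ _ _) (C X : ℂ[X][X]) X).det =
      (pencil V (blockLabel _ _ _) x y).det := fun x y => by
    have := map_det_pencil (evalEvalRingHom x y) (fun c => evalEval_CC x y c) V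
      (blockLabel _ _ _) (C X) X
    rw [coe_evalEvalRingHom, evalEval_C, eval_X, evalEval_X] at this
    exact this
  refine ⟨_, _, _, he, hb.trans hdcard.le, ?_, V, hV, ?_, ?_⟩
  · rw [← hdcard]
    omega
  · obtain ⟨z, hz⟩ := hM.exists_det_pencil_ne_zero hφ hg hV hVeq
    intro h0
    rw [← hmap, h0, evalEval_zero] at hz
    exact hz rfl
  -- Irreducibility makes P coprime to ∂P/∂w over ℂ(z), giving a nonzero D(z) in the ideal (P,
  -- ∂P/∂w). Away from the zeros of D and of the leading coefficient, point evaluations in the disk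
  -- are bounded.
  · have hder : ¬ P ∣ P.derivative := fun h => by
      have h1 : P.derivative ≠ 0 := fun h => hm (derivative_eq_zero.1 h)
      exact absurd (natDegree_le_of_dvd h h1) (not_le.2 (natDegree_derivative_lt hm))
    obtain ⟨D, hD0, a, b, hD⟩ := exists_C_eq_mul_add_mul_of_irreducible hP hm hder
    have hlc0 : P.leadingCoeff ≠ 0 := leadingCoeff_ne_zero.2 hP.ne_zero
    have hinf : ((Metric.ball (0 : ℂ) 1 \ {z | D.IsRoot z}) \
        {z | P.leadingCoeff.IsRoot z}).Infinite :=
      ((infinite_of_mem_nhds (0 : ℂ) (Metric.ball_mem_nhds 0 one_pos)).sdiff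
        (finite_setOfPred_isRoot hD0)).sdiff (finite_setOfPred_isRoot hlc0)
    refine dvd_of_infinite_common_zeros hP hm hinf fun z hz => ?_
    have hz1 : ‖z‖ < 1 := by simpa using hz.1.1
    obtain ⟨w, hw⟩ := IsAlgClosed.exists_root (P.fiber z) (by
      refine fun h => hm ?_
      rw [← natDegree_fiber P z hz.2]
      exact natDegree_eq_of_degree_eq_some h)
    have hw0 : P.evalEval z w = 0 := by rw [← eval_fiber]; exact hw
    refine ⟨w, hw0, ?_⟩
    rw [hmap]
    obtain ⟨A, hA⟩ := exists_norm_evalEval_le_norm hT hι hlc hD hz1 hw0 hz.1.2 hz.2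
    let l : ℂ[X][X] →ₗ[ℂ] ℂ :=
      { toFun := fun f => f.evalEval z w
        map_add' := fun f g => evalEval_add z w f g
        map_smul' := fun c f => evalEval_smul z w c f }
    -- Boundedness is known only for w-degree ≤ m, so the functional is a Hahn–Banach extension. It
    -- is therefore multiplicative for Z on H' and for W on H only, which is what the model
    -- requires.
    obtain ⟨ev, hev⟩ := exists_functional_extending_of_mem ι
      (outerDegreeLT (P.natDegree + 1)) l A fun f hf => hA f (by
        rw [degree_le_iff_coeff_zero]
        intro k hk
        have hf' := mem_outerDegreeLT.1 hf
        rw [degree_lt_iff_coeff_zero] at hf'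
        exact hf' k (by exact_mod_cast hk))
    have hev' : ∀ f : ℂ[X][X], f.degree < (P.natDegree + 1 : ℕ) → ev (ι f) = f.evalEval z w :=
      fun f hf => hev f (mem_outerDegreeLT.2 hf)
    have hext : ∀ (T : K →ₗᵢ[ℂ] K) (c : ℂ) (k : ℕ), (∀ f : ℂ[X][X], f.degree < k →
        ev (T (ι f)) = c * ev (ι f)) → ∀ x ∈ closedImage ι k, ev (T x) = c * ev x := by
      intro T c k h x hx
      have hcl : IsClosed {x | ev (T x) = c * ev x} :=
        isClosed_eq (ev.continuous.comp T.continuous) (ev.continuous.const_smul c)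
      refine closure_minimal ?_ hcl hx
      rintro _ ⟨f, hf, rfl⟩
      exact h f (mem_outerDegreeLT.1 hf)
    refine hM.det_pencil_eq_zero hε hφ hg hVeq ev hz1 (hext Z z _ fun f hf => ?_)
      (hext W w _ fun f hf => ?_) (x₀ := ι 1) (mem_closedImage ?_) ?_
    · rw [hZ, hev' _ hf, hev', evalEval_mul, evalEval_C, eval_X]
      rwa [degree_C_mul X_ne_zero]
    · rw [hW, hev', hev', evalEval_mul, evalEval_X]
      · exact hf.trans (by exact_mod_cast Nat.lt_succ_self _)
      · rcases eq_or_ne f 0 with rfl | h0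
        · simp
        · rw [mul_comm, degree_mul_X]
          rw [degree_eq_natDegree h0] at hf ⊢
          norm_cast at hf ⊢
          omega
    · rw [degree_one]
      exact_mod_cast hmpos
    · rw [hev', evalEval_one]
      · exact one_ne_zero
      · rw [degree_one]
        exact_mod_cast Nat.succ_pos _

/-! ### Transfer between ℂ[z,w] and ℂ[z][w], with degrees and coefficients. -/

namespace Poly2

/-- The isomorphism `ℂ[z,w] ≃ ℂ[z][w]` as a homomorphism. -/
noncomputable def toBivariate : Poly2 →ₐ[ℂ] ℂ[X][X] := MvPolynomial.aeval ![C X, X]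

/-- The inverse of `toBivariate`. -/
noncomputable def ofBivariate : ℂ[X][X] →+* Poly2 :=
  eval₂RingHom (Polynomial.aeval (MvPolynomial.X 0 : Poly2)).toRingHom (MvPolynomial.X 1)

theorem ofBivariate_toBivariate (p : Poly2) : ofBivariate (toBivariate p) = p := by
  have h : (ofBivariate.comp toBivariate.toRingHom) = RingHom.id Poly2 := by
    refine MvPolynomial.ringHom_ext (fun c => ?_) fun i => ?_
    · simp [toBivariate, ofBivariate, Polynomial.algebraMap_apply]
    · fin_cases i <;> simp [toBivariate, ofBivariate]
  exact RingHom.congr_fun h p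

theorem toBivariate_ofBivariate (f : ℂ[X][X]) : toBivariate (ofBivariate f) = f := by
  have h : (toBivariate.toRingHom.comp ofBivariate) = RingHom.id ℂ[X][X] := by
    refine Polynomial.ringHom_ext' (Polynomial.ringHom_ext' ?_ ?_) ?_
    · ext c; simp [toBivariate, ofBivariate, Polynomial.algebraMap_apply]
    · simp [toBivariate, ofBivariate]
    · simp [toBivariate, ofBivariate]
  exact RingHom.congr_fun h f

theorem toBivariate_dvd_iff {p q : Poly2} : toBivariate p ∣ toBivariate q ↔ p ∣ q := by
  constructor
  · rintro ⟨r, hr⟩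
    refine ⟨ofBivariate r, ?_⟩
    rw [← ofBivariate_toBivariate q, hr, map_mul, ofBivariate_toBivariate]
  · rintro ⟨r, rfl⟩
    exact ⟨toBivariate r, map_mul _ _ _⟩

theorem irreducible_toBivariate {p : Poly2} (hp : Irreducible p) : Irreducible (toBivariate p) := by
  let e : Poly2 ≃+* ℂ[X][X] :=
    { toBivariate.toRingHom with
      invFun := ofBivariate
      left_inv := ofBivariate_toBivariate
      right_inv := toBivariate_ofBivariate }
  exact (MulEquiv.irreducible_iff e).2 hp

theorem evalEval_toBivariate (p : Poly2) (x y : ℂ) :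
    (toBivariate p).evalEval x y = MvPolynomial.eval ![x, y] p := by
  have h : (evalEvalRingHom x y).comp toBivariate.toRingHom = MvPolynomial.eval ![x, y] := by
    refine MvPolynomial.ringHom_ext (fun c => ?_) fun i => ?_
    · simp [toBivariate, Polynomial.algebraMap_apply]
    · fin_cases i <;> simp [toBivariate]
  exact RingHom.congr_fun h p

theorem coeff_zero_toBivariate (p : Poly2) : (toBivariate p).coeff 0 = atWZero p := by
  have h : constantCoeff.comp toBivariate.toRingHom =
      (MvPolynomial.aeval ![X, 0] : Poly2 →ₐ[ℂ] ℂ[X]).toRingHom := by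
    refine MvPolynomial.ringHom_ext (fun c => ?_) fun i => ?_
    · simp [toBivariate, Polynomial.algebraMap_apply]
    · fin_cases i <;> simp [toBivariate]
  exact RingHom.congr_fun h p

theorem coeff_coeff_toBivariate (p : Poly2) (s : Fin 2 →₀ ℕ) :
    ((toBivariate p).coeff (s 1)).coeff (s 0) = p.coeff s := by
  induction p using MvPolynomial.induction_on' with
  | monomial t a =>
    have h1 : toBivariate (MvPolynomial.monomial t a) = C (C a * X ^ t 0) * X ^ t 1 := by
      rw [toBivariate, MvPolynomial.aeval_monomial, Finsupp.prod_fintype _ _ (by simp)]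
      simp [Fin.prod_univ_two, Polynomial.algebraMap_apply, mul_assoc]
    rw [h1, coeff_C_mul_X_pow, MvPolynomial.coeff_monomial]
    have h2 : t = s ↔ s 1 = t 1 ∧ s 0 = t 0 := by
      rw [Finsupp.ext_iff, Fin.forall_fin_two]
      constructor <;> rintro ⟨h, h'⟩ <;> exact ⟨h'.symm, h.symm⟩
    split_ifs with h3 h4 h4
    · rw [coeff_C_mul_X_pow, if_pos (h2.1 h4).2]
    · rw [coeff_C_mul_X_pow, if_neg fun h5 => h4 (h2.2 ⟨h3, h5⟩)]
    · exact absurd (h2.1 h4).1 h3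
    · simp
  | add p q hp hq => rw [map_add, coeff_add, coeff_add, MvPolynomial.coeff_add, hp, hq]

theorem exists_finsupp (i j : ℕ) : ∃ s : Fin 2 →₀ ℕ, s 0 = i ∧ s 1 = j :=
  ⟨Finsupp.single 0 i + Finsupp.single 1 j, by simp, by simp⟩

theorem natDegree_toBivariate (p : Poly2) : (toBivariate p).natDegree = p.degreeOf 1 := by
  refine le_antisymm ?_ ?_
  · rw [natDegree_le_iff_coeff_eq_zero]
    intro j hj
    ext i
    obtain ⟨s, rfl, rfl⟩ := exists_finsupp i j
    rw [coeff_coeff_toBivariate, coeff_zero]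
    by_contra h
    exact absurd (MvPolynomial.monomial_le_degreeOf 1 (MvPolynomial.mem_support_iff.2 h))
      (not_le.2 hj)
  · rw [MvPolynomial.degreeOf_le_iff]
    intro s hs
    refine le_natDegree_of_ne_zero fun h => MvPolynomial.mem_support_iff.1 hs ?_
    rw [← coeff_coeff_toBivariate, h, coeff_zero]

theorem natDegree_coeff_toBivariate_le (p : Poly2) (j : ℕ) :
    ((toBivariate p).coeff j).natDegree ≤ p.degreeOf 0 := by
  rw [natDegree_le_iff_coeff_eq_zero]
  intro i hi
  obtain ⟨s, rfl, rfl⟩ := exists_finsupp i j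
  rw [coeff_coeff_toBivariate]
  by_contra h
  exact absurd (MvPolynomial.monomial_le_degreeOf 0 (MvPolynomial.mem_support_iff.2 h))
    (not_le.2 hi)

theorem exists_natDegree_coeff_toBivariate_eq {p : Poly2} (hp : p ≠ 0) :
    ∃ j, (toBivariate p).coeff j ≠ 0 ∧ ((toBivariate p).coeff j).natDegree = p.degreeOf 0 := by
  obtain ⟨s, hs, hs0⟩ := Finset.exists_mem_eq_sup p.support
    (MvPolynomial.support_nonempty.2 hp) (fun s => s 0)
  rw [← MvPolynomial.degreeOf_eq_sup] at hs0
  have hne : ((toBivariate p).coeff (s 1)).coeff (s 0) ≠ 0 := by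
    rw [coeff_coeff_toBivariate]
    exact MvPolynomial.mem_support_iff.1 hs
  refine ⟨s 1, fun h => hne (by rw [h, coeff_zero]),
    le_antisymm (natDegree_coeff_toBivariate_le p _) ?_⟩
  rw [hs0]
  exact le_natDegree_of_ne_zero hne

theorem eq_C_of_degreeOf_eq_zero {q : Poly2} (h0 : q.degreeOf 0 = 0) (h1 : q.degreeOf 1 = 0) :
    ∃ c, q = MvPolynomial.C c := by
  refine ⟨q.coeff 0, ?_⟩
  ext s
  rw [MvPolynomial.coeff_C]
  split_ifs with hs
  · rw [hs]
  · by_contra hne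
    have hmem := MvPolynomial.mem_support_iff.2 hne
    have e0 := MvPolynomial.monomial_le_degreeOf 0 hmem
    have e1 := MvPolynomial.monomial_le_degreeOf 1 hmem
    refine hs ?_
    ext i
    fin_cases i
    · simp at e0 ⊢; omega
    · simp at e1 ⊢; omega

theorem degreeOf_det_le {I : Type*} [Fintype I] [DecidableEq I] (k : Fin 2) (M : Matrix I I Poly2)
    (B : I → ℕ) (h : ∀ i j, (M i j).degreeOf k ≤ B j) : M.det.degreeOf k ≤ ∑ j, B j := by
  rw [Matrix.det_apply']
  refine (MvPolynomial.degreeOf_sum_le _ _ _).trans (Finset.sup_le fun σ _ => ?_)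
  have h1 : (((Equiv.Perm.sign σ : ℤ) : Poly2)) =
      MvPolynomial.C ((Equiv.Perm.sign σ : ℤ) : ℂ) := by simp
  rw [h1]
  refine (MvPolynomial.degreeOf_C_mul_le _ _ _).trans ?_
  refine (MvPolynomial.degreeOf_prod_le _ _ _).trans ?_
  exact Finset.sum_le_sum fun j _ => h _ j

/-! ### Assembling unitary representations factor by factor. -/

/-- `p` is a constant multiple of `det (UΔ - Γ)` with `m` blocks of type `w`, `a` blocks of the
first type in `z` and `b` blocks of the second type in `z`. -/
def HasUnitaryRep (p : Poly2) (m a b : ℕ) : Prop :=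
  ∃ (I : Type) (_ : Fintype I) (_ : DecidableEq I) (κ : I → Fin 3),
    Fintype.card {i // κ i = 0} = m ∧ Fintype.card {i // κ i = 1} = a ∧
    Fintype.card {i // κ i = 2} = b ∧
    ∃ U ∈ Matrix.unitaryGroup I ℂ, ∃ c : ℂ, c ≠ 0 ∧
      p = MvPolynomial.C c * (pencil U κ (z : Poly2) w).det

theorem degreeOf_pencil_apply_le {I : Type*} [Fintype I] [DecidableEq I] (U : Matrix I I ℂ)
    (κ : I → Fin 3) (k : Fin 2) (B : Fin 3 → ℕ)
    (h1 : ∀ l : Fin 3, MvPolynomial.degreeOf k ((![w, z, 1] : Fin 3 → Poly2) l) ≤ B l)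
    (h2 : ∀ l : Fin 3, MvPolynomial.degreeOf k ((![1, 1, z] : Fin 3 → Poly2) l) ≤ B l) (i j : I) :
    (pencil U κ (z : Poly2) w i j).degreeOf k ≤ B (κ j) := by
  rw [pencil, Matrix.sub_apply, Matrix.mul_diagonal, Matrix.map_apply,
    MvPolynomial.algebraMap_eq]
  refine (MvPolynomial.degreeOf_sub_le _ _ _).trans (max_le ?_ ?_)
  · exact (MvPolynomial.degreeOf_C_mul_le _ _ _).trans (h1 _)
  · rw [Matrix.diagonal_apply]
    split_ifs with hij
    · rw [hij]; exact h2 _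
    · simp

theorem degreeOf_one_det_pencil_le {e a b : ℕ} (V : Matrix (Fin e ⊕ (Fin a ⊕ Fin b)) _ ℂ) :
    ((pencil V (blockLabel _ _ _) (z : Poly2) w).det).degreeOf 1 ≤ e := by
  refine (degreeOf_det_le 1 _ _ (degreeOf_pencil_apply_le V (blockLabel _ _ _) 1 ![1, 0, 0]
    ?_ ?_)).trans ?_
  · intro l; fin_cases l <;> simp [z, w, MvPolynomial.degreeOf_X]
  · intro l; fin_cases l <;> simp [z, MvPolynomial.degreeOf_X]
  · simp [Fintype.sum_sum_type, blockLabel]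

theorem degreeOf_zero_det_pencil_le {e a b : ℕ} (V : Matrix (Fin e ⊕ (Fin a ⊕ Fin b)) _ ℂ) :
    ((pencil V (blockLabel _ _ _) (z : Poly2) w).det).degreeOf 0 ≤ a + b := by
  refine (degreeOf_det_le 0 _ _ (degreeOf_pencil_apply_le V (blockLabel _ _ _) 0 ![0, 1, 1]
    ?_ ?_)).trans ?_
  · intro l; fin_cases l <;> simp [z, w, MvPolynomial.degreeOf_X]
  · intro l; fin_cases l <;> simp [z]
  · simp [Fintype.sum_sum_type, blockLabel]

theorem NoFactorInZAlone.ne_zero {p : Poly2} (h : p.NoFactorInZAlone) : p ≠ 0 := by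
  rintro rfl
  have := h z (dvd_zero _) (by simp [z, MvPolynomial.degreeOf_X])
  simp [z] at this

theorem NoFactorInZAlone.of_dvd {p q : Poly2} (h : p.NoFactorInZAlone) (hq : q ∣ p) :
    q.NoFactorInZAlone := fun r hr => h r (hr.trans hq)

theorem IsGenDistinguished.of_dvd {p q : Poly2} (h : p.IsGenDistinguished) (hq : q ∣ p) :
    q.IsGenDistinguished := by
  obtain ⟨r, rfl⟩ := hq
  refine fun x hx => h ?_
  have hx' : MvPolynomial.eval ![x.1, x.2] q = 0 := hx
  change MvPolynomial.eval ![x.1, x.2] (q * r) = 0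
  rw [map_mul, hx', zero_mul]

theorem IsGenDistinguished.norm_eq_one {p : Poly2} (h : p.IsGenDistinguished) {x y : ℂ}
    (hx : ‖x‖ = 1) (hxy : MvPolynomial.eval ![x, y] p = 0) : ‖y‖ = 1 := by
  rcases h (show (x, y) ∈ p.zeroSet from hxy) with (h1 | h1) | h1
  · exact absurd hx (ne_of_lt h1.1)
  · exact h1.2
  · exact absurd hx (ne_of_gt h1.1)

theorem IsGenDistinguished.atWZero_ne_zero {p : Poly2} (h : p.IsGenDistinguished) :
    p.atWZero ≠ 0 := fun h0 => by
  have h1 : MvPolynomial.eval ![1, 0] p = 0 := by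
    rw [← evalEval_toBivariate, evalEval, C_0, ← coeff_zero_eq_eval_zero, coeff_zero_toBivariate,
      h0, eval_zero]
  have := h.norm_eq_one (by simp) h1
  simp at this

theorem numZerosDisk_mul {p q : Poly2} (h : p.atWZero * q.atWZero ≠ 0) :
    (p * q).numZerosDisk = p.numZerosDisk + q.numZerosDisk := by
  have h1 : (p * q).atWZero = p.atWZero * q.atWZero := map_mul _ p q
  rw [numZerosDisk, h1, roots_mul h, Multiset.filter_add, Multiset.card_add]
  rfl

theorem hasUnitaryRep_C {c : ℂ} (hc : c ≠ 0) : HasUnitaryRep (MvPolynomial.C c) 0 0 0 := by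
  refine ⟨Empty, inferInstance, inferInstance, fun i => i.elim, Fintype.card_eq_zero, Fintype.card_eq_zero,
    Fintype.card_eq_zero, 1, one_mem _, c, hc, ?_⟩
  rw [Matrix.det_isEmpty, mul_one]

theorem toBivariate_z : toBivariate z = C X := by simp [toBivariate, z]

theorem toBivariate_w : toBivariate w = X := by simp [toBivariate, w]

theorem toBivariate_det_pencil {I : Type*} [Fintype I] [DecidableEq I] (U : Matrix I I ℂ)
    (κ : I → Fin 3) :
    toBivariate (pencil U κ (z : Poly2) w).det = (pencil U κ (C X : ℂ[X][X]) X).det := by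
  have h := map_det_pencil (toBivariate : Poly2 →+* ℂ[X][X]) toBivariate.commutes U κ z w
  rw [RingHom.coe_coe, toBivariate_z, toBivariate_w] at h
  exact h

/-- A degree squeeze: the determinant is p·q of degree at most (a + b, e), with e ≤ m, b ≤ n₂ and a
+ n₂ ≤ n. Hence q is constant and all these inequalities are equalities. -/
theorem hasUnitaryRep_of_irreducible {p : Poly2} (hp : Irreducible p)
    (hm : p.degreeOf 1 ≠ 0) (hgdv : p.IsGenDistinguished) :
    ∃ a, a + p.numZerosDisk = p.degreeOf 0 ∧
      HasUnitaryRep p (p.degreeOf 1) a p.numZerosDisk := by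
  obtain ⟨e, a, b, he, hb, ha, V, hV, hdet0, hdvd⟩ := exists_unitary_dvd_det_pencil
    (irreducible_toBivariate hp) (by rwa [natDegree_toBivariate])
    (fun x y hx hxy => hgdv.norm_eq_one hx (by rwa [← evalEval_toBivariate]))
    (natDegree_coeff_toBivariate_le p) (exists_natDegree_coeff_toBivariate_eq hp.ne_zero)
  have hcard : Multiset.card (((toBivariate p).coeff 0).roots.filter fun x => ‖x‖ < 1) =
      p.numZerosDisk := by
    rw [coeff_zero_toBivariate, numZerosDisk]
    congr 1
  rw [natDegree_toBivariate] at he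
  rw [hcard] at ha hb
  set Q := (pencil V (blockLabel (Fin e) (Fin a) (Fin b)) (z : Poly2) w).det with hQ
  have hmap : toBivariate Q =
      (pencil V (blockLabel (Fin e) (Fin a) (Fin b)) (C X : ℂ[X][X]) X).det := by
    rw [hQ, toBivariate_det_pencil]
  rw [← hmap] at hdvd hdet0
  have hQ0 : Q ≠ 0 := fun h => hdet0 (by rw [h, map_zero])
  obtain ⟨q, hq⟩ := toBivariate_dvd_iff.1 hdvd
  have hq0 : q ≠ 0 := by rintro rfl; exact hQ0 (by rw [hq, mul_zero])
  have d1 := degreeOf_one_det_pencil_le V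
  have d0 := degreeOf_zero_det_pencil_le V
  rw [← hQ, hq, MvPolynomial.degreeOf_mul_eq hp.ne_zero hq0] at d1 d0
  obtain ⟨c, rfl⟩ := eq_C_of_degreeOf_eq_zero (q := q) (by omega) (by omega)
  have hc : c ≠ 0 := by rintro rfl; exact hq0 (map_zero _)
  refine ⟨a, by omega, Fin e ⊕ (Fin a ⊕ Fin b), inferInstance, inferInstance,
    blockLabel _ _ _, ?_, ?_, ?_, V, hV, c⁻¹, inv_ne_zero hc, ?_⟩
  · rw [Fintype.card_subtype, Finset.card_filter, Fintype.sum_sum_type, Fintype.sum_sum_type]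
    simp [blockLabel]
    omega
  · rw [Fintype.card_subtype, Finset.card_filter, Fintype.sum_sum_type, Fintype.sum_sum_type]
    simp [blockLabel]
  · rw [Fintype.card_subtype, Finset.card_filter, Fintype.sum_sum_type, Fintype.sum_sum_type]
    simp [blockLabel]
    omega
  · have h1 : p = MvPolynomial.C c⁻¹ * Q := by
      rw [hq, mul_left_comm, ← MvPolynomial.C_mul, inv_mul_cancel₀ hc, MvPolynomial.C_1, mul_one]
    conv_lhs => rw [h1, hQ]

/-- The block sum of two unitaries has a block-diagonal pencil. Labelling indices by `κ` instead of
fixing their order lets the two index types simply be joined. -/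
theorem HasUnitaryRep.mul {p q : Poly2} {m a b m' a' b' : ℕ} (hp : HasUnitaryRep p m a b)
    (hq : HasUnitaryRep q m' a' b') : HasUnitaryRep (p * q) (m + m') (a + a') (b + b') := by
  obtain ⟨I, _, _, κ, h0, h1, h2, U, hU, c, hc, rfl⟩ := hp
  obtain ⟨I', _, _, κ', h0', h1', h2', U', hU', c', hc', rfl⟩ := hq
  have hcard : ∀ k : Fin 3, Fintype.card {i // Sum.elim κ κ' i = k} =
      Fintype.card {i // κ i = k} + Fintype.card {i // κ' i = k} := fun k => by
    simp only [Fintype.card_subtype, Finset.card_filter, Fintype.sum_sum_type, Sum.elim_inl,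
      Sum.elim_inr]
    congr!
  refine ⟨I ⊕ I', inferInstance, inferInstance, Sum.elim κ κ', by rw [← h0, ← h0', ← hcard],
    by rw [← h1, ← h1', ← hcard], by rw [← h2, ← h2', ← hcard], Matrix.fromBlocks U 0 0 U', ?_,
    c * c', mul_ne_zero hc hc', ?_⟩
  · rw [Matrix.mem_unitaryGroup_iff] at hU hU' ⊢
    rw [Matrix.star_eq_conjTranspose] at hU hU' ⊢
    rw [Matrix.fromBlocks_conjTranspose, Matrix.fromBlocks_multiply]
    simp [hU, hU', Matrix.fromBlocks_one]
  · have hblock : pencil (Matrix.fromBlocks U 0 0 U') (Sum.elim κ κ') (z : Poly2) w =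
        Matrix.fromBlocks (pencil U κ (z : Poly2) w) 0 0 (pencil U' κ' (z : Poly2) w) := by
      ext i j
      rcases i with i | i <;> rcases j with j | j <;>
        simp [pencil, Matrix.mul_diagonal, Matrix.diagonal_apply, diagDelta, diagGamma]
    rw [hblock, Matrix.det_fromBlocks_zero₂₁, MvPolynomial.C_mul]
    ring

/-- Induction over prime factors: a prime factor free of w would also be free of z by `hfac`, hence
a nonzero constant and a unit. So each prime factor falls under the irreducible case. -/
theorem exists_hasUnitaryRep (p : Poly2) (hfac : p.NoFactorInZAlone)
    (hgdv : p.IsGenDistinguished) :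
    ∃ a, a + p.numZerosDisk = p.degreeOf 0 ∧
      HasUnitaryRep p (p.degreeOf 1) a p.numZerosDisk := by
  induction p using UniqueFactorizationMonoid.induction_on_prime with
  | h₁ => exact absurd rfl hfac.ne_zero
  | h₂ p hp =>
    obtain ⟨q, hq⟩ := hp.exists_right_inv
    have hp0 : p ≠ 0 := hp.ne_zero
    have hq0 : q ≠ 0 := by rintro rfl; simp at hq
    have d := fun k => MvPolynomial.degreeOf_mul_eq (n := k) hp0 hq0
    simp only [hq, MvPolynomial.degreeOf_one] at d
    obtain ⟨c, rfl⟩ := eq_C_of_degreeOf_eq_zero (q := p) (by have := d 0; omega)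
      (by have := d 1; omega)
    have hc : c ≠ 0 := by rintro rfl; exact hp0 (map_zero _)
    have hz : numZerosDisk (MvPolynomial.C c) = 0 := by
      have h1 : atWZero (MvPolynomial.C c) = C c := by
        simp [atWZero]
      rw [numZerosDisk, h1, roots_C]
      simp
    refine ⟨0, ?_, ?_⟩
    · rw [hz, MvPolynomial.degreeOf_C]
    · rw [hz, MvPolynomial.degreeOf_C]
      exact hasUnitaryRep_C hc
  | h₃ p q hp0 hq ih =>
    obtain ⟨a, ha, hrep⟩ := ih (hfac.of_dvd (dvd_mul_left _ _)) (hgdv.of_dvd (dvd_mul_left _ _))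
    have hqg : q.IsGenDistinguished := hgdv.of_dvd (dvd_mul_right _ _)
    have hqm : q.degreeOf 1 ≠ 0 := fun h => by
      obtain ⟨c, rfl⟩ := eq_C_of_degreeOf_eq_zero (hfac q (dvd_mul_right _ _) h) h
      have hc : c ≠ 0 := by rintro rfl; exact hq.ne_zero (map_zero _)
      exact hq.not_isUnit ((isUnit_iff_ne_zero.2 hc).map MvPolynomial.C)
    obtain ⟨a', ha', hrep'⟩ := hasUnitaryRep_of_irreducible hq.irreducible hqm hqg
    have hz : (q * p).numZerosDisk = q.numZerosDisk + p.numZerosDisk :=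
      numZerosDisk_mul (mul_ne_zero hqg.atWZero_ne_zero
        (hgdv.of_dvd (dvd_mul_left p q)).atWZero_ne_zero)
    have hdeg := fun k => MvPolynomial.degreeOf_mul_eq (n := k) hq.ne_zero hp0
    refine ⟨a' + a, ?_, ?_⟩
    · rw [hz, hdeg]; omega
    · rw [hz, hdeg]
      exact hrep'.mul hrep

/-- Equal fibre sizes give a bijection of indices matching the labels; simultaneous permutation of
rows and columns preserves unitarity and the determinant. -/
theorem HasUnitaryRep.exists_unitaryGroup {p : Poly2} {m a b : ℕ} (h : HasUnitaryRep p m a b) :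
    ∃ U ∈ Matrix.unitaryGroup (Fin m ⊕ (Fin a ⊕ Fin b)) ℂ, ∃ c : ℂ, c ≠ 0 ∧
      p = MvPolynomial.C c *
        (U.map (MvPolynomial.C : ℂ →+* Poly2) * Delta m a b - Gamma m a b).det := by
  obtain ⟨I, _, _, κ, h0, h1, h2, U, hU, c, hc, rfl⟩ := h
  have hfib : ∀ k : Fin 3, Nonempty ({i // blockLabel (Fin m) (Fin a) (Fin b) i = k} ≃
      {i // κ i = k}) := fun k => by
    refine ⟨Fintype.equivOfCardEq ?_⟩
    rw [Fintype.card_subtype, Finset.card_filter, Fintype.sum_sum_type, Fintype.sum_sum_type]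
    fin_cases k
    · simpa [blockLabel] using h0.symm
    · simpa [blockLabel] using h1.symm
    · simpa [blockLabel] using h2.symm
  let e : Fin m ⊕ (Fin a ⊕ Fin b) ≃ I :=
    (Equiv.sigmaFiberEquiv _).symm.trans
      ((Equiv.sigmaCongrRight fun k => (hfib k).some).trans (Equiv.sigmaFiberEquiv κ))
  have he : ∀ i, κ (e i) = blockLabel (Fin m) (Fin a) (Fin b) i := fun i =>
    ((hfib _).some ⟨i, rfl⟩).2
  refine ⟨U.submatrix e e, ?_, c, hc, ?_⟩
  · rw [Matrix.mem_unitaryGroup_iff] at hU ⊢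
    rw [Matrix.star_eq_conjTranspose] at hU ⊢
    rw [Matrix.conjTranspose_submatrix, Matrix.submatrix_mul_equiv, hU, Matrix.submatrix_one_equiv]
  · congr 1
    rw [← Matrix.det_submatrix_equiv_self e]
    congr 1
    ext1 i j
    rw [Matrix.submatrix_apply, pencil, Matrix.sub_apply, Matrix.sub_apply, Matrix.mul_diagonal,
      Delta, Matrix.mul_diagonal, Gamma, Matrix.diagonal_apply, Matrix.diagonal_apply]
    simp only [diagDelta, diagGamma, he, EmbeddingLike.apply_eq_iff_eq]
    congr 1
    · congr 1
      rcases j with j | j | j <;> simp [blockLabel]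
    · congr 1
      rcases i with i | i | i <;> simp [blockLabel]

end Poly2

theorem mainTheorem10 (p : Poly2) (n m : ℕ)
    (hdeg : p.HasBidegree n m)
    (hfac : p.NoFactorInZAlone)
    (hgdv : p.IsGenDistinguished) :
    ∃ n₁ : ℕ, n₁ + p.numZerosDisk = n ∧
      ∃ U ∈ Matrix.unitaryGroup (Fin m ⊕ (Fin n₁ ⊕ Fin p.numZerosDisk)) ℂ,
        ∃ c : ℂ, c ≠ 0 ∧
          p = MvPolynomial.C c *
            (U.map (MvPolynomial.C : ℂ →+* Poly2) * Poly2.Delta m n₁ p.numZerosDisk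
              - Poly2.Gamma m n₁ p.numZerosDisk).det := by
  obtain ⟨a, ha, hrep⟩ := Poly2.exists_hasUnitaryRep p hfac hgdv
  obtain ⟨rfl, rfl⟩ := hdeg
  exact ⟨a, ha, hrep.exists_unitaryGroup⟩
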